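/- Let $S$ be a finite semigroup and $k$ a commutative semiring with unit. Modules over a $k$-algebra $A$ (not necessarily unital) are right modules. A module $M$ with $MA\neq 0$ is simple if every congruence on $M$ with more than one class is trivial, minimal if it has no proper nonzero submodule, and irreducible if it is both. Let $\mathrm{rad}(M)$ be the intersection of all maximal (proper) congruences on $M$, and let $\mathrm{Soc}(M)$ be the submodule generated by all minimal submodules of $M$. Let $e\in S$ be an idempotent, $J$, $R$, $L$ its $\mathscr J$-, $\mathscr R$- and $\mathscr L$-class, and $G_J$ the group of units of $eSe$. Put $N_J=\{s\in S\mid J\nsubseteq S^1sS^1\}$ and $A_J=kS/kN_J$. A $kS$-module $M$ has apex $J$ if $\{s\in S\mid Ms=0\}=N_J$. For a $kG_J$-module $V$ let $$\mathrm{Ind}_J(V)=V\otimes_{kG_J}eA_J,\qquad \mathrm{Coind}_J(V)=\mathrm{Hom}_{kG_J}(A_Je,V),$$ and let $V\otimes C_J\colon \mathrm{Ind}_J(V)\to\mathrm{Coind}_J(V)$ be the $kS$-morphism $v\otimes x\mapsto (y\mapsto v\cdot(xy))$, where $xy\in eA_Je\cong kG_J$. Theorem. Let $V$ be an irreducible $kG_J$-module.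 1. The image of $V\otimes C_J$ is the irreducible $kS$-module corresponding to $V$: it is irreducible with apex $J$, it satisfies $Me\cong V$ as a $kG_J$-module (where $M$ is the image), and every irreducible $kS$-module $M'$ with apex $J$ and $M'e\cong V$ is isomorphic to it. 2. Let $T\subseteq R$ be a complete set of representatives $\lambda_b$ of the $\mathscr L$-classes of $J$, and $T'\subseteq L$ a complete set of representatives $\rho_a$ of the $\mathscr R$-classes of $J$. Let $C_J$ be the sandwich matrix: $(C_J)_{ba}=\lambda_b\rho_a\in G_J$ if $\lambda_b\rho_a\in J$, and $(C_J)_{ba}=0$ otherwise. Then $f\mapsto (f(\rho_a))_a$ is a bijection $\mathrm{Coind}_J(V)\to V^{T'}$. In these coordinates, $V\otimes C_J$ sends $v\otimes\lambda_b$ to the row $(v(C_J)_{ba})_a$. For every set $X$ spanning $V$ over $k$, the image of $V\otimes C_J$ is the $k$-span of the rows $(v(C_J)_{ba})_a$ with $v\in X$ and $\lambda_b\in T$. 3. The morphism $V\otimes C_J$ is nonzero. The map $\varphi\mapsto\bigl(v\mapsto\varphi(v\otimes e)(e)\bigr)$ is a $k$-linear isomorphism $\mathrm{Hom}_{kS}(\mathrm{Ind}_J(V),\mathrm{Coind}_J(V))\cong\mathrm{Hom}_{kG_J}(V,V)$.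 For every nonzero $\varphi\in\mathrm{Hom}_{kS}(\mathrm{Ind}_J(V),\mathrm{Coind}_J(V))$, the kernel congruence of $\varphi$ is $\mathrm{rad}(\mathrm{Ind}_J(V))$, and its image equals the image of $V\otimes C_J$ and equals $\mathrm{Soc}(\mathrm{Coind}_J(V))$. -/

import Mathlib

open scoped TensorProduct

namespace SgpRep

noncomputable section

universe u v w x

/-! ### Right modules over a (not necessarily unital) algebra over a commutative semiring -/

section Modules

/-- A right module over the `k`-algebra `A` (`k` a commutative semiring, `A` not necessarily
unital): a `k`-module `M` with a `k`-bilinear associative right action of `A`. -/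
class RightModule (k : Type*) (A : Type*) (M : Type*) [CommSemiring k] [NonUnitalSemiring A]
    [Module k A] [AddCommMonoid M] [Module k M] where
  /-- `act m a` is the product `m a`. -/
  act : M →ₗ[k] A →ₗ[k] M
  act_mul : ∀ (m : M) (a b : A), act m (a * b) = act (act m a) b

variable (k : Type*) (A : Type*) [CommSemiring k] [NonUnitalSemiring A] [Module k A]
variable (M : Type*) [AddCommMonoid M] [Module k M] [RightModule k A M]
variable (N : Type*) [AddCommMonoid N] [Module k N] [RightModule k A N]

variable {A M} in
/-- The product `m a` of a module element and an algebra element. -/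
def act (m : M) (a : A) : M := RightModule.act (k := k) m a

/-- `A`-submodules. -/
structure RSubmodule extends Submodule k M where
  act_mem : ∀ m ∈ carrier, ∀ a : A, act k m a ∈ carrier

variable {k A M} in
/-- A submodule is a module. -/
instance (P : RSubmodule k A M) : RightModule k A P.toSubmodule where
  act := LinearMap.mk₂ k (fun m a => ⟨act k m.1 a, P.act_mem m.1 m.2 a⟩)
    (fun _ _ _ => Subtype.ext (by simp [act])) (fun _ _ _ => Subtype.ext (by simp [act]))
    (fun _ _ _ => Subtype.ext (by simp [act])) (fun _ _ _ => Subtype.ext (by simp [act]))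
  act_mul m a b := Subtype.ext (RightModule.act_mul m.1 a b)

/-- Congruences on an `A`-module. -/
structure RCon extends ModuleCon k M where
  act : ∀ {m m' : M} (a : A), r m m' → r (SgpRep.act k m a) (SgpRep.act k m' a)

variable {k A M} in
/-- A congruence is proper if it has more than one class. -/
def RCon.IsProper (R : RCon k A M) : Prop := ∃ m m', ¬ R.r m m'

variable {k A M} in
/-- A congruence is trivial if all its classes are singletons. -/
def RCon.IsTrivial (R : RCon k A M) : Prop := ∀ m m', R.r m m' → m = m'

variable {k A M} in
/-- A maximal congruence: maximal among the proper ones. -/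
def RCon.IsMaximal (R : RCon k A M) : Prop :=
  R.IsProper ∧ ∀ R' : RCon k A M, R'.IsProper → (∀ m m', R.r m m' → R'.r m m') →
    ∀ m m', R'.r m m' → R.r m m'

/-- `M A ≠ 0`. -/
def ActsNontrivially : Prop := ∃ (m : M) (a : A), act k m a ≠ 0

/-- Simple modules: `M A ≠ 0`, and `M` and `0` are the only quotients of `M`. -/
def IsSimpleMod : Prop :=
  ActsNontrivially k A M ∧ ∀ R : RCon k A M, R.IsProper → R.IsTrivial

/-- Minimal modules: `M A ≠ 0`, and there are no proper nonzero submodules. -/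
def IsMinimalMod : Prop :=
  ActsNontrivially k A M ∧ ∀ P : RSubmodule k A M, P.toSubmodule = ⊥ ∨ P.toSubmodule = ⊤

/-- Irreducible modules: both simple and minimal. -/
def IsIrreducibleMod : Prop := IsSimpleMod k A M ∧ IsMinimalMod k A M

/-- The radical: the intersection of all maximal congruences. -/
def radical (m m' : M) : Prop := ∀ R : RCon k A M, R.IsMaximal → R.r m m'

/-- The socle: the submodule generated by all minimal submodules. (A sum of `A`-submodules,
formed in the lattice of `k`-submodules, is closed under `A`.) -/
def socle : Submodule k M :=
  ⨆ P : RSubmodule k A M, ⨆ _ : IsMinimalMod k A P.toSubmodule, P.toSubmodule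

/-- The `k`-module `Hom_A(M, N)`. -/
def RHom : Submodule k (M →ₗ[k] N) where
  carrier := {f | ∀ (m : M) (a : A), f (act k m a) = act k (f m) a}
  add_mem' hf hg m a := by
    have h1 := hf m a
    have h2 := hg m a
    simp only [act] at h1 h2 ⊢
    simp [h1, h2]
  zero_mem' m a := by simp [act]
  smul_mem' c f hf m a := by
    have h1 := hf m a
    simp only [act] at h1 ⊢
    simp [h1]

variable {k A M N} in
/-- The image of a homomorphism of `A`-modules. -/
def image (f : RHom k A M N) : RSubmodule k A N where
  toSubmodule := LinearMap.range f.1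
  act_mem := by
    rintro _ ⟨m, rfl⟩ a
    exact ⟨act k m a, f.2 m a⟩

/-- Isomorphy of `A`-modules. -/
def RIso : Prop := ∃ f : M ≃ₗ[k] N, ∀ (m : M) (a : A), f (act k m a) = act k (f m) a

end Modules

/-! ### Semigroups -/

section Semigroups

variable {S : Type v} [Semigroup S]

/-- `J(s) = S¹ s S¹`. -/
def principalIdeal (s : S) : Set S := {t | ∃ x y : WithOne S, (t : WithOne S) = x * s * y}

/-- `s S¹`. -/
def principalRight (s : S) : Set S := {t | ∃ y : WithOne S, (t : WithOne S) = s * y}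

/-- `S¹ s`. -/
def principalLeft (s : S) : Set S := {t | ∃ x : WithOne S, (t : WithOne S) = x * s}

/-- The `𝒥`-class of `s`. -/
def jClass (s : S) : Set S := {t | principalIdeal t = principalIdeal s}

/-- The `ℛ`-class of `s`. -/
def rClass (s : S) : Set S := {t | principalRight t = principalRight s}

/-- The `ℒ`-class of `s`. -/
def lClass (s : S) : Set S := {t | principalLeft t = principalLeft s}

/-- The ideal of all elements that are not `𝒥`-above `J`. -/
def notAbove (J : Set S) : Set S := {s | ¬ J ⊆ principalIdeal s}

variable (S) in
/-- The idempotents of `S`. -/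
abbrev Idem : Type v := {e : S // IsIdempotentElem e}

variable (e : Idem S)

/-- The monoid `eSe` with identity `e`. -/
def LocalMonoid : Type v := Subsemigroup.corner e.1

instance : Semigroup (LocalMonoid e) := inferInstanceAs (Semigroup (Subsemigroup.corner e.1))

instance : Monoid (LocalMonoid e) where
  one := ⟨e.1, (Subsemigroup.mem_corner_iff e.2).2 ⟨e.2, e.2⟩⟩
  one_mul a := Subtype.ext ((Subsemigroup.mem_corner_iff e.2).1 a.2).1
  mul_one a := Subtype.ext ((Subsemigroup.mem_corner_iff e.2).1 a.2).2

/-- The maximal subgroup `G_e` at `e`: the group of units of `eSe`. -/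
abbrev MaxSubgroup : Type v := (LocalMonoid e)ˣ

/-- The inclusion of `G_e` in `S`. -/
def incl : MaxSubgroup e →ₙ* S where
  toFun g := g.1.1
  map_mul' _ _ := rfl

theorem incl_injective : Function.Injective (incl e) :=
  fun _ _ h => Units.ext (Subtype.ext h)

theorem e_mul_incl (g : MaxSubgroup e) : e.1 * incl e g = incl e g :=
  ((Subsemigroup.mem_corner_iff e.2).1 g.1.2).1

theorem incl_mul_e (g : MaxSubgroup e) : incl e g * e.1 = incl e g :=
  ((Subsemigroup.mem_corner_iff e.2).1 g.1.2).2

theorem incl_mul_inv (g : MaxSubgroup e) : incl e g * incl e g⁻¹ = e.1 :=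
  congrArg Subtype.val (Units.mul_inv g)

theorem incl_inv_mul (g : MaxSubgroup e) : incl e g⁻¹ * incl e g = e.1 :=
  congrArg Subtype.val (Units.inv_mul g)

theorem mem_principalIdeal_self (s : S) : s ∈ principalIdeal s := ⟨1, 1, by simp⟩

theorem principalIdeal_trans {s t r : S} (h : r ∈ principalIdeal s)
    (h' : s ∈ principalIdeal t) : r ∈ principalIdeal t := by
  obtain ⟨x, y, h⟩ := h
  obtain ⟨x', y', h'⟩ := h'
  exact ⟨x * x', y' * y, by rw [h, h']; simp only [mul_assoc]⟩

theorem mul_mem_notAbove_right {J : Set S} {s : S} (hs : s ∈ notAbove J) (t : S) :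
    s * t ∈ notAbove J := fun h =>
  hs fun _ hj => principalIdeal_trans (h hj) ⟨1, t, by simp⟩

theorem mul_mem_notAbove_left {J : Set S} {s : S} (hs : s ∈ notAbove J) (t : S) :
    t * s ∈ notAbove J := fun h =>
  hs fun _ hj => principalIdeal_trans (h hj) ⟨t, 1, by simp⟩

theorem incl_notMem_notAbove (g : MaxSubgroup e) : incl e g ∉ notAbove (jClass e.1) := by
  intro h
  refine h fun j hj => principalIdeal_trans (s := e.1) ?_ ⟨1, (incl e g⁻¹ : S), ?_⟩
  · have : principalIdeal j = principalIdeal e.1 := hj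
    rw [← this]
    exact mem_principalIdeal_self j
  · rw [one_mul, ← WithOne.coe_mul, incl_mul_inv]

theorem e_mul_of_mem_rClass {s : S} (hs : s ∈ rClass e.1) : e.1 * s = s := by
  have hs' : principalRight s = principalRight e.1 := hs
  have h : s ∈ principalRight e.1 := by
    rw [← hs']
    exact ⟨1, by simp⟩
  obtain ⟨y, hy⟩ := h
  apply WithOne.coe_injective
  rw [WithOne.coe_mul, hy, ← mul_assoc, ← WithOne.coe_mul, e.2.eq]

theorem mul_e_of_mem_lClass {s : S} (hs : s ∈ lClass e.1) : s * e.1 = s := by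
  have hs' : principalLeft s = principalLeft e.1 := hs
  have h : s ∈ principalLeft e.1 := by
    rw [← hs']
    exact ⟨1, by simp⟩
  obtain ⟨y, hy⟩ := h
  apply WithOne.coe_injective
  rw [WithOne.coe_mul, hy, mul_assoc, ← WithOne.coe_mul, e.2.eq]

/-- In a finite semigroup, `eSe ∩ J_e ⊆ G_e`. -/
theorem exists_incl_eq [Finite S] {s : S} (h1 : e.1 * s = s) (h2 : s * e.1 = s)
    (hs : s ∈ jClass e.1) : ∃ g : MaxSubgroup e, incl e g = s := by
  have hs' : principalIdeal s = principalIdeal e.1 := hs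
  have h : e.1 ∈ principalIdeal s := by
    rw [hs']
    exact mem_principalIdeal_self _
  obtain ⟨x, y, hxy⟩ := h
  have key : ∃ x y : S, e.1 = x * s * y := by
    have e1 : ∀ z : WithOne S, ∃ z' : S, (e.1 : WithOne S) * z = z' := by
      intro z
      cases z with
      | one => exact ⟨e.1, by simp⟩
      | coe z => exact ⟨e.1 * z, by simp⟩
    have e2 : ∀ z : WithOne S, ∃ z' : S, z * (e.1 : WithOne S) = z' := by
      intro z
      cases z with
      | one => exact ⟨e.1, by simp⟩
      | coe z => exact ⟨z * e.1, by simp⟩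
    obtain ⟨x', hx'⟩ := e2 x
    obtain ⟨y', hy'⟩ := e1 y
    refine ⟨x', y', WithOne.coe_injective ?_⟩
    have h3 : (s : WithOne S) = e.1 * s * e.1 := by
      rw [← WithOne.coe_mul, h1, ← WithOne.coe_mul, h2]
    rw [WithOne.coe_mul, WithOne.coe_mul, ← hx', ← hy']
    calc (e.1 : WithOne S) = x * s * y := hxy
      _ = x * (e.1 * s * e.1) * y := by rw [← h3]
      _ = x * e.1 * s * (e.1 * y) := by simp only [mul_assoc]
  obtain ⟨x, y, hxy⟩ := key
  have hc : ∀ z : S, e.1 * z * e.1 ∈ Subsemigroup.corner e.1 := fun z => ⟨z, rfl⟩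
  let X : LocalMonoid e := ⟨e.1 * x * e.1, hc x⟩
  let Y : LocalMonoid e := ⟨e.1 * y * e.1, hc y⟩
  let Z : LocalMonoid e := ⟨s, (Subsemigroup.mem_corner_iff e.2).2 ⟨h1, h2⟩⟩
  have hXZY : X * (Z * Y) = 1 := by
    apply Subtype.ext
    change e.1 * x * e.1 * (s * (e.1 * y * e.1)) = e.1
    calc e.1 * x * e.1 * (s * (e.1 * y * e.1))
        = e.1 * (x * ((e.1 * s) * e.1) * y) * e.1 := by simp only [mul_assoc]
      _ = e.1 := by rw [h1, h2, ← hxy, e.2.eq, e.2.eq]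
  have : Finite (LocalMonoid e) := inferInstanceAs (Finite (Subsemigroup.corner e.1))
  have h3 : Z * (Y * X) = 1 := by
    rw [← mul_assoc]
    exact mul_eq_one_symm hXZY
  exact ⟨⟨Z, Y * X, h3, mul_eq_one_symm h3⟩, rfl⟩

end Semigroups

/-! ### The algebra `A_J = kS / k(J-not-above)` -/

section Algebra

variable (k : Type u) [CommSemiring k] {S : Type v} [Semigroup S] (e : Idem S)

/-- The `k`-submodule of `kS` spanned by the elements not `𝒥`-above the `𝒥`-class of `e`. -/
def kNotAbove : Submodule k (MonoidAlgebra k S) :=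
  Submodule.span k ((fun s => MonoidAlgebra.single s 1) '' notAbove (jClass e.1))

theorem mul_mem_kNotAbove_right {a : MonoidAlgebra k S} (ha : a ∈ kNotAbove k e)
    (b : MonoidAlgebra k S) : a * b ∈ kNotAbove k e := by
  induction b using MonoidAlgebra.induction_linear with
  | zero => simp
  | add x y hx hy => rw [mul_add]; exact add_mem hx hy
  | single t r =>
    induction ha using Submodule.span_induction with
    | mem x hx =>
      obtain ⟨s, hs, rfl⟩ := hx
      have : MonoidAlgebra.single s (1 : k) * MonoidAlgebra.single t r
          = r • MonoidAlgebra.single (s * t) (1 : k) := by simp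
      simp only [this]
      exact Submodule.smul_mem _ _ (Submodule.subset_span ⟨_, mul_mem_notAbove_right hs t, rfl⟩)
    | zero => simp
    | add x y _ _ hx hy => rw [add_mul]; exact add_mem hx hy
    | smul c x _ hx => rw [smul_mul_assoc]; exact Submodule.smul_mem _ _ hx

theorem mul_mem_kNotAbove_left {a : MonoidAlgebra k S} (ha : a ∈ kNotAbove k e)
    (b : MonoidAlgebra k S) : b * a ∈ kNotAbove k e := by
  induction b using MonoidAlgebra.induction_linear with
  | zero => simp
  | add x y hx hy => rw [add_mul]; exact add_mem hx hy
  | single t r =>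
    induction ha using Submodule.span_induction with
    | mem x hx =>
      obtain ⟨s, hs, rfl⟩ := hx
      have : MonoidAlgebra.single t r * MonoidAlgebra.single s (1 : k)
          = r • MonoidAlgebra.single (t * s) (1 : k) := by simp
      simp only [this]
      exact Submodule.smul_mem _ _ (Submodule.subset_span ⟨_, mul_mem_notAbove_left hs t, rfl⟩)
    | zero => simp
    | add x y _ _ hx hy => rw [mul_add]; exact add_mem hx hy
    | smul c x _ hx => rw [mul_smul_comm]; exact Submodule.smul_mem _ _ hx

/-- The congruence on `kS` modulo the ideal `kNotAbove`: `a ≡ b` if and only if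
`a + n = b + n'` for some `n, n'` in the ideal. -/
def algCon : RingCon (MonoidAlgebra k S) where
  r a b := ∃ n ∈ kNotAbove k e, ∃ n' ∈ kNotAbove k e, a + n = b + n'
  iseqv :=
    { refl := fun a => ⟨0, zero_mem _, 0, zero_mem _, rfl⟩
      symm := fun ⟨n, hn, n', hn', h⟩ => ⟨n', hn', n, hn, h.symm⟩
      trans := by
        rintro a b c ⟨n, hn, n', hn', h⟩ ⟨p, hp, p', hp', h'⟩
        refine ⟨n + p, add_mem hn hp, n' + p', add_mem hn' hp', ?_⟩
        rw [← add_assoc, h, add_right_comm, h', add_assoc, add_comm p' n'] }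
  add' := by
    rintro a b c d ⟨n, hn, n', hn', h⟩ ⟨p, hp, p', hp', h'⟩
    exact ⟨n + p, add_mem hn hp, n' + p', add_mem hn' hp',
      by rw [add_add_add_comm, h, h', add_add_add_comm]⟩
  mul' := by
    rintro a b c d ⟨n, hn, n', hn', h⟩ ⟨p, hp, p', hp', h'⟩
    refine ⟨a * p + (n * c + n * p), ?_, b * p' + (n' * d + n' * p'), ?_, ?_⟩
    · exact add_mem (mul_mem_kNotAbove_left k e hp _) (add_mem
        (mul_mem_kNotAbove_right k e hn _) (mul_mem_kNotAbove_right k e hn _))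
    · exact add_mem (mul_mem_kNotAbove_left k e hp' _) (add_mem
        (mul_mem_kNotAbove_right k e hn' _) (mul_mem_kNotAbove_right k e hn' _))
    · have := congrArg₂ (· * ·) h h'
      simp only [add_mul, mul_add] at this
      rw [show a * c + (a * p + (n * c + n * p)) = a * c + n * c + (a * p + n * p) by abel,
        show b * d + (b * p' + (n' * d + n' * p')) = b * d + n' * d + (b * p' + n' * p') by abel]
      exact this

/-- The algebra `A_J = kS / kNotAbove`, for `J` the `𝒥`-class of `e`. -/
def AJ : Type (max u v) := (algCon k e).Quotient

instance : NonUnitalSemiring (AJ k e) := inferInstanceAs (NonUnitalSemiring (algCon k e).Quotient)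

instance : SMul k (AJ k e) where
  smul c := Quotient.map (c • ·) (by
    rintro a b ⟨n, hn, n', hn', h⟩
    exact ⟨c • n, Submodule.smul_mem _ c hn, c • n', Submodule.smul_mem _ c hn',
      by rw [← smul_add, h, smul_add]⟩)

/-- The quotient map `kS → A_J`, additively. -/
def projAdd : MonoidAlgebra k S →+ AJ k e where
  toFun a := Quotient.mk'' a
  map_zero' := rfl
  map_add' _ _ := rfl

theorem projAdd_surjective : Function.Surjective (projAdd k e) := Quotient.mk''_surjective

instance : Module k (AJ k e) :=
  Function.Surjective.module k (projAdd k e) (projAdd_surjective k e) fun _ _ => rfl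

/-- The quotient map `kS → A_J`. -/
def proj : MonoidAlgebra k S →ₗ[k] AJ k e where
  __ := projAdd k e
  map_smul' _ _ := rfl

theorem proj_surjective : Function.Surjective (proj k e) := projAdd_surjective k e

@[simp] theorem proj_mul (a b : MonoidAlgebra k S) : proj k e (a * b) = proj k e a * proj k e b :=
  rfl

instance : IsScalarTower k (AJ k e) (AJ k e) where
  smul_assoc c x y := by
    obtain ⟨a, rfl⟩ := proj_surjective k e x
    obtain ⟨b, rfl⟩ := proj_surjective k e y
    simp only [smul_eq_mul, ← map_smul, ← proj_mul, smul_mul_assoc]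

instance : SMulCommClass k (AJ k e) (AJ k e) where
  smul_comm c x y := by
    obtain ⟨a, rfl⟩ := proj_surjective k e x
    obtain ⟨b, rfl⟩ := proj_surjective k e y
    simp only [smul_eq_mul, ← map_smul, ← proj_mul, mul_smul_comm]

/-- The class in `A_J` of an element of `S`. -/
def cls (s : S) : AJ k e := proj k e (MonoidAlgebra.single s 1)

theorem cls_mul (s t : S) : cls k e s * cls k e t = cls k e (s * t) := by
  rw [cls, cls, ← proj_mul, MonoidAlgebra.single_mul_single, one_mul, cls]

/-- Abbreviation for the group algebra `kG_e`. -/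
abbrev kG : Type (max u v) := MonoidAlgebra k (MaxSubgroup e)

/-- The map `kG_e → kS` induced by the inclusion of `G_e` in `S`. -/
def kincl : kG k e →ₙₐ[k] MonoidAlgebra k S := MonoidAlgebra.mapDomainNonUnitalAlgHom k k (incl e)

theorem kincl_single (g : MaxSubgroup e) (r : k) :
    kincl k e (MonoidAlgebra.single g r) = MonoidAlgebra.single (incl e g) r :=
  MonoidAlgebra.mapDomain_single

/-- The map `kG_e → A_J`; it identifies `kG_e` with `e A_J e` when `S` is finite. -/
def ι : kG k e →ₗ[k] AJ k e where
  toFun b := proj k e (kincl k e b)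
  map_add' _ _ := by simp
  map_smul' _ _ := by simp

theorem ι_mul (a b : kG k e) : ι k e (a * b) = ι k e a * ι k e b := by simp [ι]

theorem ι_single (g : MaxSubgroup e) (r : k) :
    ι k e (MonoidAlgebra.single g r) = r • cls k e (incl e g) := by
  change proj k e (kincl k e _) = _
  rw [kincl_single, cls, ← map_smul]
  simp

theorem cls_e_mul_ι (b : kG k e) : cls k e e.1 * ι k e b = ι k e b := by
  induction b using MonoidAlgebra.induction_linear with
  | zero => simp
  | add x y hx hy => rw [map_add, mul_add, hx, hy]
  | single g r => rw [ι_single, mul_smul_comm, cls_mul, e_mul_incl]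

theorem ι_mul_cls_e (b : kG k e) : ι k e b * cls k e e.1 = ι k e b := by
  induction b using MonoidAlgebra.induction_linear with
  | zero => simp
  | add x y hx hy => rw [map_add, add_mul, hx, hy]
  | single g r => rw [ι_single, smul_mul_assoc, cls_mul, incl_mul_e]

/-- Restriction of coefficients from `S` to `G_e`. -/
def restrictG : MonoidAlgebra k S →ₗ[k] kG k e where
  toFun := MonoidAlgebra.comapDomain (incl e) (incl_injective e)
  map_add' := MonoidAlgebra.comapDomain_add _ _
  map_smul' c a := by ext; simp

theorem restrictG_kNotAbove {n : MonoidAlgebra k S} (hn : n ∈ kNotAbove k e) :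
    restrictG k e n = 0 := by
  induction hn using Submodule.span_induction with
  | mem x hx =>
    obtain ⟨s, hs, rfl⟩ := hx
    refine MonoidAlgebra.comapDomain_single_of_not_mem_range ?_ (incl_injective e)
    rintro ⟨g, rfl⟩
    exact incl_notMem_notAbove e g hs
  | zero => simp
  | add x y _ _ hx hy => rw [map_add, hx, hy, add_zero]
  | smul c x _ hx => rw [map_smul, hx, smul_zero]

/-- The linear map `A_J → kG_e` that sends the class of `g ∈ G_e` to `g` and the classes of all
other elements of `S` to `0`. When `S` is finite, its restriction to `e A_J e` is the inverse of
the isomorphism `ι : kG_e ≅ e A_J e`. -/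
def θ : AJ k e →ₗ[k] kG k e where
  toFun := Quotient.lift (restrictG k e) (by
    rintro a b ⟨n, hn, n', hn', h⟩
    have := congrArg (restrictG k e) h
    rwa [map_add, map_add, restrictG_kNotAbove k e hn, restrictG_kNotAbove k e hn', add_zero,
      add_zero] at this)
  map_add' x y := by
    obtain ⟨a, rfl⟩ := proj_surjective k e x
    obtain ⟨b, rfl⟩ := proj_surjective k e y
    exact map_add (restrictG k e) a b
  map_smul' c x := by
    obtain ⟨a, rfl⟩ := proj_surjective k e x
    exact map_smul (restrictG k e) c a

theorem θ_cls_incl (g : MaxSubgroup e) : θ k e (cls k e (incl e g)) = MonoidAlgebra.single g 1 :=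
  MonoidAlgebra.comapDomain_single_map _ (incl_injective e) _ _

theorem θ_cls_of_notMem {s : S} (hs : s ∉ Set.range (incl e)) : θ k e (cls k e s) = 0 :=
  MonoidAlgebra.comapDomain_single_of_not_mem_range hs (incl_injective e)

theorem AJ_induction {p : AJ k e → Prop} (x : AJ k e) (h0 : p 0)
    (ha : ∀ x y, p x → p y → p (x + y)) (hs : ∀ (r : k) (s : S), p (r • cls k e s)) : p x := by
  obtain ⟨a, rfl⟩ := proj_surjective k e x
  induction a using MonoidAlgebra.induction_linear with
  | zero => simpa using h0
  | add x y hx hy => rw [map_add]; exact ha _ _ hx hy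
  | single s r =>
    have := hs r s
    rw [cls, ← map_smul] at this
    simpa using this

theorem θ_ι_mul (b : kG k e) (z : AJ k e) :
    θ k e (ι k e b * (cls k e e.1 * z)) = b * θ k e (cls k e e.1 * z) := by
  induction b using MonoidAlgebra.induction_linear with
  | zero => simp
  | add x y hx hy => rw [map_add, add_mul, map_add, hx, hy, add_mul]
  | single g r =>
    induction z using AJ_induction with
    | h0 => simp
    | ha x y hx hy => simp only [mul_add, map_add, hx, hy]
    | hs c s =>
      simp only [ι_single, mul_smul_comm, smul_mul_assoc, map_smul, cls_mul]
      congr 1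
      by_cases h : e.1 * s ∈ Set.range (incl e)
      · obtain ⟨g', hg'⟩ := h
        rw [← hg', ← map_mul, θ_cls_incl, θ_cls_incl]
        simp
      · rw [θ_cls_of_notMem k e h, θ_cls_of_notMem, smul_zero, mul_zero]
        rintro ⟨g', hg'⟩
        refine h ⟨g⁻¹ * g', ?_⟩
        rw [map_mul, hg', ← mul_assoc, incl_inv_mul, ← mul_assoc, e.2.eq]

theorem θ_mul_ι (b : kG k e) (z : AJ k e) :
    θ k e ((z * cls k e e.1) * ι k e b) = θ k e (z * cls k e e.1) * b := by
  induction b using MonoidAlgebra.induction_linear with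
  | zero => simp
  | add x y hx hy => rw [map_add, mul_add, map_add, hx, hy, mul_add]
  | single g r =>
    induction z using AJ_induction with
    | h0 => simp
    | ha x y hx hy => simp only [add_mul, map_add, hx, hy]
    | hs c s =>
      simp only [ι_single, mul_smul_comm, smul_mul_assoc, map_smul, cls_mul]
      rw [smul_comm r c]
      congr 1
      by_cases h : s * e.1 ∈ Set.range (incl e)
      · obtain ⟨g', hg'⟩ := h
        rw [← hg', ← map_mul, θ_cls_incl, θ_cls_incl]
        simp
      · rw [θ_cls_of_notMem k e h, θ_cls_of_notMem, smul_zero, zero_mul]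
        rintro ⟨g', hg'⟩
        refine h ⟨g' * g⁻¹, ?_⟩
        rw [map_mul, hg', mul_assoc, incl_mul_inv, mul_assoc, e.2.eq]

end Algebra

/-! ### The bimodules `e A_J` and `A_J e`, induction and coinduction -/

section IndCoind

variable (k : Type u) [CommSemiring k] {S : Type v} [Semigroup S] (e : Idem S)

/-- The right ideal `e A_J` of `A_J`. -/
def eA : Submodule k (AJ k e) := LinearMap.range (LinearMap.mulLeft k (cls k e e.1))

/-- The left ideal `A_J e` of `A_J`. -/
def Ae : Submodule k (AJ k e) := LinearMap.range (LinearMap.mulRight k (cls k e e.1))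

theorem mem_eA {x : AJ k e} : x ∈ eA k e ↔ cls k e e.1 * x = x := by
  constructor
  · rintro ⟨y, rfl⟩
    simp [← mul_assoc, cls_mul, e.2.eq]
  · intro h
    exact ⟨x, h⟩

theorem mem_Ae {x : AJ k e} : x ∈ Ae k e ↔ x * cls k e e.1 = x := by
  constructor
  · rintro ⟨y, rfl⟩
    simp [mul_assoc, cls_mul, e.2.eq]
  · intro h
    exact ⟨x, h⟩

/-- Left multiplication of `kG_e` on `e A_J`. -/
def leftG : kG k e →ₗ[k] eA k e →ₗ[k] eA k e :=
  LinearMap.mk₂ k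
    (fun b x => ⟨ι k e b * x.1, (mem_eA k e).2 (by rw [← mul_assoc, cls_e_mul_ι])⟩)
    (fun _ _ _ => Subtype.ext (by simp [add_mul]))
    (fun _ _ _ => Subtype.ext (by simp [smul_mul_assoc]))
    (fun _ _ _ => Subtype.ext (by simp [mul_add]))
    (fun _ _ _ => Subtype.ext (by simp [mul_smul_comm]))

/-- Right multiplication of `kS` on `e A_J`. -/
def rightS : eA k e →ₗ[k] MonoidAlgebra k S →ₗ[k] eA k e :=
  LinearMap.mk₂ k
    (fun x a => ⟨x.1 * proj k e a, (mem_eA k e).2 (by rw [← mul_assoc, (mem_eA k e).1 x.2])⟩)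
    (fun _ _ _ => Subtype.ext (by simp [add_mul]))
    (fun _ _ _ => Subtype.ext (by simp [smul_mul_assoc]))
    (fun _ _ _ => Subtype.ext (by simp [mul_add]))
    (fun _ _ _ => Subtype.ext (by simp [mul_smul_comm]))

/-- Right multiplication of `kG_e` on `A_J e`. -/
def rightG : Ae k e →ₗ[k] kG k e →ₗ[k] Ae k e :=
  LinearMap.mk₂ k
    (fun y b => ⟨y.1 * ι k e b, (mem_Ae k e).2 (by rw [mul_assoc, ι_mul_cls_e])⟩)
    (fun _ _ _ => Subtype.ext (by simp [add_mul]))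
    (fun _ _ _ => Subtype.ext (by simp [smul_mul_assoc]))
    (fun _ _ _ => Subtype.ext (by simp [mul_add]))
    (fun _ _ _ => Subtype.ext (by simp [mul_smul_comm]))

/-- Left multiplication of `kS` on `A_J e`. -/
def leftS : MonoidAlgebra k S →ₗ[k] Ae k e →ₗ[k] Ae k e :=
  LinearMap.mk₂ k
    (fun a y => ⟨proj k e a * y.1, (mem_Ae k e).2 (by rw [mul_assoc, (mem_Ae k e).1 y.2])⟩)
    (fun _ _ _ => Subtype.ext (by simp [add_mul]))
    (fun _ _ _ => Subtype.ext (by simp [smul_mul_assoc]))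
    (fun _ _ _ => Subtype.ext (by simp [mul_add]))
    (fun _ _ _ => Subtype.ext (by simp [mul_smul_comm]))

/-- The class in `e A_J` of an element of the `ℛ`-class of `e`. -/
def ofR (s : rClass e.1) : eA k e :=
  ⟨cls k e s.1, (mem_eA k e).2 (by rw [cls_mul, e_mul_of_mem_rClass e s.2])⟩

/-- The class in `A_J e` of an element of the `ℒ`-class of `e`. -/
def ofL (s : lClass e.1) : Ae k e :=
  ⟨cls k e s.1, (mem_Ae k e).2 (by rw [cls_mul, mul_e_of_mem_lClass e s.2])⟩

/-- The map `C_J : e A_J × A_J e → e A_J e ≅ kG_e` induced by multiplication. -/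
def pairing : eA k e →ₗ[k] Ae k e →ₗ[k] kG k e :=
  LinearMap.mk₂ k (fun x y => θ k e (x.1 * y.1))
    (fun _ _ _ => by simp [add_mul]) (fun _ _ _ => by simp [smul_mul_assoc])
    (fun _ _ _ => by simp [mul_add]) (fun _ _ _ => by simp [mul_smul_comm])

theorem pairing_left (b : kG k e) (x : eA k e) (y : Ae k e) :
    pairing k e (leftG k e b x) y = b * pairing k e x y := by
  change θ k e (ι k e b * x.1 * y.1) = b * θ k e (x.1 * y.1)
  rw [mul_assoc, ← (mem_eA k e).1 x.2, mul_assoc (cls k e e.1), θ_ι_mul]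

theorem pairing_right (b : kG k e) (x : eA k e) (y : Ae k e) :
    pairing k e x (rightG k e y b) = pairing k e x y * b := by
  change θ k e (x.1 * (y.1 * ι k e b)) = θ k e (x.1 * y.1) * b
  rw [← mul_assoc, ← (mem_Ae k e).1 y.2, ← mul_assoc x.1, θ_mul_ι]

theorem pairing_assoc (x : eA k e) (a : MonoidAlgebra k S) (y : Ae k e) :
    pairing k e (rightS k e x a) y = pairing k e x (leftS k e a y) :=
  congrArg (θ k e) (mul_assoc x.1 (proj k e a) y.1)

variable (V : Type w) [AddCommMonoid V] [Module k V] [RightModule k (kG k e) V]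

/-- The congruence on `V ⊗_k e A_J` generated by `v b ⊗ x ∼ v ⊗ b x` for `b` in `kG_e`. -/
def indCon : ModuleCon k (V ⊗[k] eA k e) :=
  SMulCon.addConGen'
    (fun t t' => ∃ (v : V) (b : kG k e) (x : eA k e),
      t = act k v b ⊗ₜ[k] x ∧ t' = v ⊗ₜ[k] leftG k e b x)
    (by
      rintro c _ _ ⟨v, b, x, rfl, rfl⟩
      exact ⟨c • v, b, x, by simp [act, TensorProduct.smul_tmul'],
        by simp [TensorProduct.smul_tmul']⟩)

/-- `Ind_J(V) = V ⊗_{kG_e} e A_J`. -/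
def Ind : Type (max u v w) := (indCon k e V).Quotient

instance : AddCommMonoid (Ind k e V) := inferInstanceAs (AddCommMonoid (indCon k e V).Quotient)

instance : Module k (Ind k e V) := inferInstanceAs (Module k (indCon k e V).Quotient)

/-- The quotient map from `V ⊗_k e A_J` to `V ⊗_{kG_e} e A_J`. -/
def Ind.quot : V ⊗[k] eA k e →ₗ[k] Ind k e V where
  toFun t := Quotient.mk'' t
  map_add' _ _ := rfl
  map_smul' _ _ := rfl

theorem Ind.quot_surjective : Function.Surjective (Ind.quot k e V) := Quotient.mk''_surjective

/-- The element `v ⊗ x` of `V ⊗_{kG_e} e A_J`. -/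
def Ind.tmul : V →ₗ[k] eA k e →ₗ[k] Ind k e V :=
  (TensorProduct.mk k V (eA k e)).compr₂ (Ind.quot k e V)

theorem Ind.tmul_act (v : V) (b : kG k e) (x : eA k e) :
    Ind.tmul k e V (act k v b) x = Ind.tmul k e V v (leftG k e b x) :=
  Quotient.sound (AddConGen.Rel.of _ _ ⟨v, b, x, rfl, rfl⟩)

variable {k e V} in
/-- The universal property of `V ⊗_{kG_e} e A_J`. -/
def Ind.lift {P : Type*} [AddCommMonoid P] [Module k P] (f : V →ₗ[k] eA k e →ₗ[k] P)
    (hf : ∀ v b x, f (act k v b) x = f v (leftG k e b x)) : Ind k e V →ₗ[k] P where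
  toFun := Quotient.lift (TensorProduct.lift f) (by
    intro t t' h
    have : (indCon k e V).toAddCon ≤ AddCon.ker (TensorProduct.lift f).toAddMonoidHom := by
      refine AddCon.addConGen_le.2 ?_
      rintro _ _ ⟨v, b, x, rfl, rfl⟩
      refine (AddCon.ker_rel _).2 ?_
      simpa using hf v b x
    exact this h)
  map_add' x y := by
    obtain ⟨a, rfl⟩ := Ind.quot_surjective k e V x
    obtain ⟨b, rfl⟩ := Ind.quot_surjective k e V y
    exact map_add (TensorProduct.lift f) a b
  map_smul' c x := by
    obtain ⟨a, rfl⟩ := Ind.quot_surjective k e V x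
    exact map_smul (TensorProduct.lift f) c a

@[simp] theorem Ind.lift_tmul {P : Type*} [AddCommMonoid P] [Module k P]
    (f : V →ₗ[k] eA k e →ₗ[k] P) (hf : ∀ v b x, f (act k v b) x = f v (leftG k e b x))
    (v : V) (x : eA k e) : Ind.lift f hf (Ind.tmul k e V v x) = f v x :=
  TensorProduct.lift.tmul v x

theorem Ind.induction {p : Ind k e V → Prop} (z : Ind k e V) (h0 : p 0)
    (ha : ∀ x y, p x → p y → p (x + y)) (ht : ∀ v x, p (Ind.tmul k e V v x)) : p z := by
  obtain ⟨t, rfl⟩ := Ind.quot_surjective k e V z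
  induction t using TensorProduct.induction_on with
  | zero => simpa using h0
  | tmul v x => exact ht v x
  | add x y hx hy => rw [map_add]; exact ha _ _ hx hy

/-- The right action `(v ⊗ x) a = v ⊗ x a` of `kS` on `Ind_J(V)`. -/
def Ind.actHom : Ind k e V →ₗ[k] MonoidAlgebra k S →ₗ[k] Ind k e V :=
  Ind.lift
    (LinearMap.mk₂ k (fun v x => (Ind.tmul k e V v).comp (rightS k e x))
      (fun _ _ _ => by ext; simp) (fun _ _ _ => by ext; simp)
      (fun _ _ _ => by ext; simp) (fun _ _ _ => by ext; simp))
    (fun v b x => by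
      refine LinearMap.ext fun a => ?_
      refine (Ind.tmul_act k e V v b _).trans ?_
      refine congrArg (Ind.tmul k e V v) (Subtype.ext ?_)
      exact (mul_assoc (ι k e b) x.1 (proj k e a)).symm)

theorem Ind.actHom_tmul (v : V) (x : eA k e) (a : MonoidAlgebra k S) :
    Ind.actHom k e V (Ind.tmul k e V v x) a = Ind.tmul k e V v (rightS k e x a) := by
  simp [Ind.actHom]

instance : RightModule k (MonoidAlgebra k S) (Ind k e V) where
  act := Ind.actHom k e V
  act_mul z a b := by
    induction z using Ind.induction with
    | h0 => simp
    | ha x y hx hy => simp only [map_add, LinearMap.add_apply, hx, hy]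
    | ht v x =>
      rw [Ind.actHom_tmul, Ind.actHom_tmul, Ind.actHom_tmul]
      refine congrArg (Ind.tmul k e V v) (Subtype.ext ?_)
      exact (mul_assoc x.1 (proj k e a) (proj k e b)).symm

/-- `Coind_J(V) = Hom_{kG_e}(A_J e, V)`. -/
def Coind : Submodule k (Ae k e →ₗ[k] V) where
  carrier := {f | ∀ (y : Ae k e) (b : kG k e), f (rightG k e y b) = act k (f y) b}
  add_mem' hf hg y b := by
    have h1 := hf y b
    have h2 := hg y b
    simp only [act] at h1 h2 ⊢
    simp [h1, h2]
  zero_mem' y b := by simp [act]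
  smul_mem' c f hf y b := by
    have h1 := hf y b
    simp only [act] at h1 ⊢
    simp [h1]

/-- The right action of `kS` on `Coind_J(V)`: `(f a)(y) = f(a y)`. -/
instance : RightModule k (MonoidAlgebra k S) (Coind k e V) where
  act := LinearMap.mk₂ k
    (fun f a => ⟨f.1.comp (leftS k e a), fun y b => by
      have : leftS k e a (rightG k e y b) = rightG k e (leftS k e a y) b :=
        Subtype.ext (mul_assoc _ _ _).symm
      rw [LinearMap.comp_apply, this]
      exact f.2 _ b⟩)
    (fun _ _ _ => Subtype.ext (by ext; simp)) (fun _ _ _ => Subtype.ext (by ext; simp))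
    (fun _ _ _ => Subtype.ext (by ext; simp)) (fun _ _ _ => Subtype.ext (by ext; simp))
  act_mul f a b := by
    refine Subtype.ext (LinearMap.ext fun y => ?_)
    exact congrArg f.1 (Subtype.ext (mul_assoc (proj k e a) (proj k e b) y.1))

/-- The element `y ↦ v C_J(x, y)` of `Coind_J(V)`. -/
def VC₀ (v : V) (x : eA k e) : Coind k e V :=
  ⟨(RightModule.act (k := k) v).comp (pairing k e x), fun y b => by
    rw [LinearMap.comp_apply, pairing_right]
    exact RightModule.act_mul _ _ _⟩

/-- The map `(v, x) ↦ (y ↦ v C_J(x, y))`. -/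
def VC₁ : V →ₗ[k] eA k e →ₗ[k] Coind k e V :=
  LinearMap.mk₂ k (VC₀ k e V)
    (fun _ _ _ => Subtype.ext (LinearMap.ext fun _ => by simp [VC₀]))
    (fun _ _ _ => Subtype.ext (LinearMap.ext fun _ => by simp [VC₀]))
    (fun _ _ _ => Subtype.ext (LinearMap.ext fun _ => by simp [VC₀]))
    (fun _ _ _ => Subtype.ext (LinearMap.ext fun _ => by simp [VC₀]))

theorem VC₁_act (v : V) (b : kG k e) (x : eA k e) :
    VC₁ k e V (act k v b) x = VC₁ k e V v (leftG k e b x) := by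
  refine Subtype.ext (LinearMap.ext fun y => ?_)
  change act k (act k v b) (pairing k e x y) = act k v (pairing k e (leftG k e b x) y)
  rw [pairing_left]
  exact (RightModule.act_mul v b _).symm

/-- The morphism `V ⊗ C_J : Ind_J(V) → Coind_J(V)`, which sends `v ⊗ x` to the map
`y ↦ v C_J(x, y)`. -/
def VC : RHom k (MonoidAlgebra k S) (Ind k e V) (Coind k e V) :=
  ⟨Ind.lift (VC₁ k e V) (VC₁_act k e V), fun z a => by
    induction z using Ind.induction with
    | h0 => simp [act]
    | ha x y hx hy =>
      simp only [act, map_add, LinearMap.add_apply] at hx hy ⊢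
      rw [hx, hy]
    | ht v x =>
      have h : act k (Ind.tmul k e V v x) a = Ind.tmul k e V v (rightS k e x a) :=
        Ind.actHom_tmul k e V v x a
      rw [h, Ind.lift_tmul, Ind.lift_tmul]
      refine Subtype.ext (LinearMap.ext fun y => ?_)
      exact congrArg (act k v) (pairing_assoc k e x a y)⟩

end IndCoind

/-! ### The apex and the restriction `M ↦ M e` -/

section Apex

variable (k : Type u) [CommSemiring k] {S : Type v} [Semigroup S]
variable (M : Type w) [AddCommMonoid M] [Module k M] [RightModule k (MonoidAlgebra k S) M]

variable (S) in
/-- `Ann M = {s ∈ S | M s = 0}`. -/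
def ann : Set S := {s | ∀ m : M, act k m (MonoidAlgebra.single s (1 : k)) = 0}

/-- The subset `J` of `S` is the apex of `M`: `J` is a regular `𝒥`-class (a `𝒥`-class that
contains an idempotent), and `Ann M` is the set of elements not `𝒥`-above `J`. -/
def HasApex (J : Set S) : Prop := (∃ f : Idem S, J = jClass f.1) ∧ ann k S M = notAbove J

variable (e : Idem S)

/-- The `k`-module `M e`. -/
def Res : Submodule k M :=
  LinearMap.range
    ((RightModule.act (k := k) (A := MonoidAlgebra k S) (M := M)).flip (MonoidAlgebra.single e.1 1))

/-- `M e` is a right `kG_e`-module, by restriction of the action of `kS`. -/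
instance : RightModule k (kG k e) (Res k M e) where
  act := LinearMap.mk₂ k
    (fun m b => ⟨act k m.1 (kincl k e b), act k m.1 (kincl k e b), by
      have h : kincl k e b * MonoidAlgebra.single e.1 1 = kincl k e b := by
        induction b using MonoidAlgebra.induction_linear with
        | zero => simp
        | add x y hx hy => rw [map_add, add_mul, hx, hy]
        | single g r => simp [kincl_single, incl_mul_e]
      change RightModule.act _ _ = act k _ _
      rw [act, ← RightModule.act_mul, h]⟩)
    (fun _ _ _ => Subtype.ext (by simp [act])) (fun _ _ _ => Subtype.ext (by simp [act]))
    (fun _ _ _ => Subtype.ext (by simp [act])) (fun _ _ _ => Subtype.ext (by simp [act]))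
  act_mul m a b := Subtype.ext (by
    change act k m.1 (kincl k e (a * b)) = act k (act k m.1 (kincl k e a)) (kincl k e b)
    rw [map_mul]
    exact RightModule.act_mul _ _ _)

/-- `M` is an irreducible `kS`-module corresponding to the irreducible `kG_e`-module `V`:
it is irreducible, its apex is the `𝒥`-class of `e`, and `M e ≅ V`. -/
def Corresponds (V : Type x) [AddCommMonoid V] [Module k V] [RightModule k (kG k e) V] : Prop :=
  IsIrreducibleMod k (MonoidAlgebra k S) M ∧ HasApex k M (jClass e.1) ∧
    RIso k (kG k e) (Res k M e) V

end Apex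

/-! ### The sandwich matrix -/

section Sandwich

variable {S : Type v} [Semigroup S] (e : Idem S)

/-- `T ⊆ R_e` is a complete set of representatives of the `ℒ`-classes of `J_e`. -/
def IsLTransversal (T : Set S) : Prop :=
  T ⊆ rClass e.1 ∧ ∀ s ∈ jClass e.1, ∃! t, t ∈ T ∧ t ∈ lClass s

/-- `T' ⊆ L_e` is a complete set of representatives of the `ℛ`-classes of `J_e`. -/
def IsRTransversal (T' : Set S) : Prop :=
  T' ⊆ lClass e.1 ∧ ∀ s ∈ jClass e.1, ∃! t, t ∈ T' ∧ t ∈ rClass s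

variable (k : Type u) [CommSemiring k] [Finite S] {e}

theorem exists_incl_eq_mul {T T' : Set S} (hT : IsLTransversal e T) (hT' : IsRTransversal e T')
    (b : T) (a : T') (h : b.1 * a.1 ∈ jClass e.1) :
    ∃ g : MaxSubgroup e, incl e g = b.1 * a.1 :=
  exists_incl_eq e (by rw [← mul_assoc, e_mul_of_mem_rClass e (hT.1 b.2)])
    (by rw [mul_assoc, mul_e_of_mem_lClass e (hT'.1 a.2)]) h

open Classical in
/-- The sandwich matrix `C_J`, with entries in `G_e ∪ {0} ⊆ kG_e`: the entry at `(λ, ρ)` is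
the element `λρ` of `G_e` if `λρ ∈ J_e`, and `0` otherwise. -/
def sandwich {T T' : Set S} (hT : IsLTransversal e T) (hT' : IsRTransversal e T') :
    Matrix T T' (kG k e) := fun b a =>
  if h : b.1 * a.1 ∈ jClass e.1 then
    MonoidAlgebra.single (exists_incl_eq_mul hT hT' b a h).choose 1
  else 0

variable (V : Type w) [AddCommMonoid V] [Module k V] [RightModule k (kG k e) V]

/-- The vector `v • (row b of C_J) = (v (C_J)_{ba})_a` in `V^{T'}`. -/
def row {T T' : Set S} (hT : IsLTransversal e T) (hT' : IsRTransversal e T') (v : V) (b : T) :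
    T' → V := fun a => act k v (sandwich k hT hT' b a)

/-- The coordinate map `Coind_J(V) → V^{T'}`, `f ↦ (f(ρ))_ρ`. -/
def coords {T' : Set S} (hT' : IsRTransversal e T') : Coind k e V →ₗ[k] (T' → V) where
  toFun f a := f.1 (ofL k e ⟨a.1, hT'.1 a.2⟩)
  map_add' _ _ := rfl
  map_smul' _ _ := rfl

end Sandwich

end

end SgpRep

open SgpRep

namespace SgpRep

universe u v w x


/-! ### Pulling congruences and submodules back along semilinear maps -/

section Modules

variable {k : Type*} {A B : Type*} [CommSemiring k] [NonUnitalSemiring A] [Module k A]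
variable [NonUnitalSemiring B] [Module k B]
variable {M : Type*} [AddCommMonoid M] [Module k M] [RightModule k A M]
variable {N : Type*} [AddCommMonoid N] [Module k N] [RightModule k B N]

/-! Write `VC` for `V ⊗ C_J`. Two facts reduce everything to `V`: the vectors `v ⊗ e` generate
`Ind_J(V)`, and an element `f` of `Coind_J(V)` is determined by the values `(f a)(e)`. The hinge is
the identity `f e = VC(f(e) ⊗ e)` (`Coind.act_e`). It rests on `e A_J e = kG_e`, which comes from
finiteness of `S`.

If `f ≠ 0` lies in a submodule `P` of `Coind_J(V)`, some `w = (f a)(e)` is nonzero and `P` contains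
`f a e = VC(w ⊗ e)`. Minimality of `V` then puts every `VC(v ⊗ e)` in `P`, hence the whole image
(`image_VC_le`). So the image is the least nonzero submodule; it is minimal and equals the socle.
Without subtraction, congruences need a parallel argument: if two distinct elements of the image are
related, so are `VC(w ⊗ e)` and `VC(w' ⊗ e)` for some `w ≠ w'`, and simplicity of `V` makes the
congruence universal. The same argument on `Ind_J(V)` puts every proper congruence inside the kernel
of every `φ` (`RCon.le_ker`). The kernel of a nonzero `φ` is thus the greatest proper congruence,
which is the radical.

For uniqueness, an isomorphism `ψ : M e ≅ V` yields `m ↦ (y ↦ ψ(m y))` from `M` to `Coind_J(V)`; it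
is injective by simplicity of `M`, and its range is the image of `VC` by minimality. A homomorphism
`φ` is recovered from `v ↦ φ(v ⊗ e)(e)` by the hinge identity. The coordinates come from the unique
factorization of the elements of `J ∩ S e` as `ρ g` with `ρ ∈ T'` and `g ∈ G_e`. -/

theorem act_mul (m : M) (a b : A) : act k m (a * b) = act k (act k m a) b :=
  RightModule.act_mul m a b

@[simp] theorem zero_act (a : A) : act k (0 : M) a = 0 := by simp [act]

@[simp] theorem act_zero (m : M) : act k m (0 : A) = 0 := by simp [act]

theorem add_act (m m' : M) (a : A) : act k (m + m') a = act k m a + act k m' a := by simp [act]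

theorem act_add (m : M) (a b : A) : act k m (a + b) = act k m a + act k m b := by simp [act]

theorem smul_act (c : k) (m : M) (a : A) : act k (c • m) a = c • act k m a := by simp [act]

theorem act_smul (c : k) (m : M) (a : A) : act k m (c • a) = c • act k m a := by simp [act]

/-- The preimage of a congruence under a linear map that is semilinear for the actions. -/
def RCon.comap (R : RCon k B N) (f : M →ₗ[k] N) (σ : A → B)
    (hf : ∀ m a, f (SgpRep.act k m a) = SgpRep.act k (f m) (σ a)) : RCon k A M where
  r m m' := R.r (f m) (f m')
  iseqv := ⟨fun _ => R.iseqv.refl _, fun h => R.iseqv.symm h, fun h h' => R.iseqv.trans h h'⟩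
  add' h h' := by
    simp only [map_add]
    exact R.add' h h'
  smul c _ _ h := by
    simp only [map_smul]
    exact R.smul c h
  act a h := by
    simp only [hf]
    exact R.act _ h

/-- The preimage of a submodule under a linear map that is semilinear for the actions. -/
def RSubmodule.comap (P : RSubmodule k B N) (f : M →ₗ[k] N) (σ : A → B)
    (hf : ∀ m a, f (SgpRep.act k m a) = SgpRep.act k (f m) (σ a)) : RSubmodule k A M where
  toSubmodule := P.toSubmodule.comap f
  act_mem m hm a := by
    change f (SgpRep.act k m a) ∈ P.toSubmodule
    rw [hf]
    exact P.act_mem _ hm _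

/-- The congruence of equality. -/
def RCon.equality : RCon k A M where
  r := Eq
  iseqv := eq_equivalence
  add' h h' := by rw [h, h']
  smul c _ _ h := by rw [h]
  act a h := by rw [h]

/-- The kernel congruence of a homomorphism. -/
def RHom.ker {N : Type*} [AddCommMonoid N] [Module k N] [RightModule k A N]
    (f : RHom k A M N) : RCon k A M :=
  RCon.comap RCon.equality f.1 id f.2

/-- The pulled-back congruence identifies two distinct elements of a simple module, so it is not
proper. The map `σ` lets the algebras differ; it will be `kincl : kG_e → kS`. -/
theorem IsSimpleMod.rel_map (hM : IsSimpleMod k A M) (R : RCon k B N) (f : M →ₗ[k] N) (σ : A → B)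
    (hf : ∀ m a, f (act k m a) = act k (f m) (σ a)) {m m' : M} (hne : m ≠ m')
    (h : R.r (f m) (f m')) (n n' : M) : R.r (f n) (f n') := by
  by_contra hn
  exact hne (hM.2 (R.comap f σ hf) ⟨n, n', hn⟩ m m' h)

/-- The preimage of `P` is a submodule of a minimal module with a nonzero element, hence everything.
-/
theorem IsMinimalMod.map_mem (hM : IsMinimalMod k A M) (P : RSubmodule k B N) (f : M →ₗ[k] N)
    (σ : A → B) (hf : ∀ m a, f (act k m a) = act k (f m) (σ a)) {m : M} (hne : m ≠ 0)
    (h : f m ∈ P.toSubmodule) (n : M) : f n ∈ P.toSubmodule := by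
  rcases hM.2 (P.comap f σ hf) with hb | ht
  · have : m ∈ (P.comap f σ hf).toSubmodule := h
    rw [hb] at this
    exact absurd this hne
  · have : n ∈ (P.comap f σ hf).toSubmodule := by rw [ht]; trivial
    exact this

theorem ActsNontrivially.exists_ne_zero (hM : ActsNontrivially k A M) : ∃ m : M, m ≠ 0 := by
  obtain ⟨m, a, h⟩ := hM
  exact ⟨_, h⟩

/-- The identity of a unital algebra acts as the identity of a minimal module. -/
theorem IsMinimalMod.act_one {A : Type*} [Semiring A] [Module k A] [RightModule k A M]
    (hM : IsMinimalMod k A M) (m : M) : act k m (1 : A) = m := by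
  -- The vectors fixed by `1` form a submodule. It contains all products `m a`, so it is nonzero
  -- because `M A ≠ 0`.
  let P : RSubmodule k A M :=
    { carrier := {m | act k m (1 : A) = m}
      add_mem' := fun {a b} ha hb => by
        change act k (a + b) (1 : A) = a + b
        rw [add_act, show act k a (1 : A) = a from ha, show act k b (1 : A) = b from hb]
      zero_mem' := zero_act _
      smul_mem' := fun c {x} hx => by
        change act k (c • x) (1 : A) = c • x
        rw [smul_act, show act k x (1 : A) = x from hx]
      act_mem := fun m _ a => by
        change act k (act k m a) (1 : A) = act k m a
        rw [← act_mul, mul_one] }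
  rcases hM.2 P with hb | ht
  · obtain ⟨m, a, h⟩ := hM.1
    have : act k m a ∈ P.toSubmodule := by
      change act k (act k m a) (1 : A) = act k m a
      rw [← act_mul, mul_one]
    rw [hb] at this
    exact absurd this h
  · have : m ∈ P.toSubmodule := by rw [ht]; trivial
    exact this

end Modules

/-! ### The element `e` in `e A_J` and `A_J e`, and `e A_J e ≅ kG_e` -/

section Units

variable {k : Type u} [CommSemiring k] {S : Type v} [Semigroup S] (e : Idem S)

theorem mem_principalIdeal_of_mem_jClass {s : S} (hs : s ∈ jClass e.1) :
    e.1 ∈ principalIdeal s := by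
  have hs' : principalIdeal s = principalIdeal e.1 := hs
  rw [hs']
  exact mem_principalIdeal_self _

theorem mem_jClass_of_mem {s : S} (h : e.1 ∈ principalIdeal s) (h' : s ∈ principalIdeal e.1) :
    s ∈ jClass e.1 :=
  Set.ext fun _ => ⟨fun ht => principalIdeal_trans ht h', fun ht => principalIdeal_trans ht h⟩

/-- `J` is a single `𝒥`-class, so an ideal that contains `e` contains all of `J`. -/
theorem mem_notAbove_iff {s : S} : s ∈ notAbove (jClass e.1) ↔ e.1 ∉ principalIdeal s := by
  refine not_congr ⟨fun h => h rfl, fun h t ht => principalIdeal_trans ?_ h⟩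
  have ht' : principalIdeal t = principalIdeal e.1 := ht
  rw [← ht']
  exact mem_principalIdeal_self t

theorem mem_principalIdeal_mul_left (s t : S) : s * t ∈ principalIdeal s := ⟨1, t, by simp⟩

theorem mem_principalIdeal_mul_right (s t : S) : s * t ∈ principalIdeal t := ⟨s, 1, by simp⟩

theorem incl_mem_jClass (g : MaxSubgroup e) : incl e g ∈ jClass e.1 := by
  refine mem_jClass_of_mem e ?_ ?_
  · rw [← incl_mul_inv e g]
    exact mem_principalIdeal_mul_left _ _
  · rw [← e_mul_incl e g]
    exact mem_principalIdeal_mul_left _ _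

theorem incl_one : incl e 1 = e.1 := rfl

variable (k)

theorem cls_of_mem_notAbove {s : S} (hs : s ∈ notAbove (jClass e.1)) : cls k e s = 0 :=
  Quotient.sound ⟨0, zero_mem _, MonoidAlgebra.single s 1,
    Submodule.subset_span ⟨s, hs, rfl⟩, by
      change _ = 0 + _
      rw [add_zero, zero_add]⟩

/-- Take `z = e` in `θ_ι_mul` and use `θ(e) = 1`. -/
theorem θ_ι (b : kG k e) : θ k e (ι k e b) = b := by
  have h := θ_ι_mul k e b (cls k e e.1)
  have h1 : θ k e (cls k e e.1) = 1 := by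
    have := θ_cls_incl k e 1
    rwa [incl_one] at this
  rwa [cls_mul, e.2.eq, ι_mul_cls_e, h1, mul_one] at h

/-- In a finite semigroup, `ι` maps `kG_e` onto `e A_J e`. -/
theorem exists_ι_eq [Finite S] (z : AJ k e) :
    ∃ b, ι k e b = cls k e e.1 * z * cls k e e.1 := by
  induction z using AJ_induction with
  | h0 => exact ⟨0, by simp⟩
  | ha x y hx hy =>
    obtain ⟨a, ha⟩ := hx
    obtain ⟨b, hb⟩ := hy
    exact ⟨a + b, by rw [map_add, ha, hb, mul_add, add_mul]⟩
  | hs r s =>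
    rw [mul_smul_comm, smul_mul_assoc, cls_mul, cls_mul]
    -- Either `e s e` is not above `J` and vanishes in `A_J`, or it lies in `eSe ∩ J = G_e`.
    by_cases h : e.1 * s * e.1 ∈ notAbove (jClass e.1)
    · exact ⟨0, by rw [cls_of_mem_notAbove k e h, map_zero, smul_zero]⟩
    · rw [mem_notAbove_iff, not_not] at h
      obtain ⟨g, hg⟩ := exists_incl_eq e (s := e.1 * s * e.1)
        (by simp only [← mul_assoc, e.2.eq]) (by rw [mul_assoc, e.2.eq])
        (mem_jClass_of_mem e h (mem_principalIdeal_mul_right _ _))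
      exact ⟨MonoidAlgebra.single g r, by rw [ι_single, hg]⟩

/-- The element `e` of `e A_J`. -/
noncomputable def unitR : eA k e := ⟨cls k e e.1, (mem_eA k e).2 (by rw [cls_mul, e.2.eq])⟩

/-- The element `e` of `A_J e`. -/
noncomputable def unitL : Ae k e := ⟨cls k e e.1, (mem_Ae k e).2 (by rw [cls_mul, e.2.eq])⟩

/-- This makes the vectors `v ⊗ e` generate `Ind_J(V)`. The mirror statement `exists_leftS_unitL`
makes `f ∈ Coind_J(V)` depend only on the values `(f a)(e)`. -/
theorem exists_rightS_unitR (x : eA k e) : ∃ a, rightS k e (unitR k e) a = x := by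
  obtain ⟨a, ha⟩ := proj_surjective k e x.1
  exact ⟨a, Subtype.ext (by
    change cls k e e.1 * proj k e a = x.1
    rw [ha, (mem_eA k e).1 x.2])⟩

theorem exists_leftS_unitL (y : Ae k e) : ∃ a, leftS k e a (unitL k e) = y := by
  obtain ⟨a, ha⟩ := proj_surjective k e y.1
  exact ⟨a, Subtype.ext (by
    change proj k e a * cls k e e.1 = y.1
    rw [ha, (mem_Ae k e).1 y.2])⟩

theorem leftG_unitR (b : kG k e) :
    leftG k e b (unitR k e) = rightS k e (unitR k e) (kincl k e b) :=
  Subtype.ext ((ι_mul_cls_e k e b).trans (cls_e_mul_ι k e b).symm)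

theorem rightG_unitL (b : kG k e) :
    rightG k e (unitL k e) b = leftS k e (kincl k e b) (unitL k e) :=
  Subtype.ext ((cls_e_mul_ι k e b).trans (ι_mul_cls_e k e b).symm)

theorem rightS_unitR_e : rightS k e (unitR k e) (MonoidAlgebra.single e.1 (1 : k)) = unitR k e :=
  Subtype.ext (by
    change cls k e e.1 * cls k e e.1 = cls k e e.1
    rw [cls_mul, e.2.eq])

theorem exists_rightS_e [Finite S] (x : eA k e) :
    ∃ b, rightS k e x (MonoidAlgebra.single e.1 (1 : k)) = leftG k e b (unitR k e) := by
  obtain ⟨b, hb⟩ := exists_ι_eq k e x.1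
  refine ⟨b, Subtype.ext ?_⟩
  change x.1 * cls k e e.1 = ι k e b * cls k e e.1
  rw [ι_mul_cls_e, hb, (mem_eA k e).1 x.2]

/-- Since `y = y e`, the product `e y` lies in `e A_J e`; it is therefore `ι b`, and `θ` recovers
`b`. -/
theorem leftS_e_eq [Finite S] (y : Ae k e) :
    leftS k e (MonoidAlgebra.single e.1 (1 : k)) y
      = rightG k e (unitL k e) (pairing k e (unitR k e) y) := by
  obtain ⟨b, hb⟩ := exists_ι_eq k e y.1
  rw [mul_assoc, (mem_Ae k e).1 y.2] at hb
  refine Subtype.ext ?_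
  change cls k e e.1 * y.1 = cls k e e.1 * ι k e (θ k e (cls k e e.1 * y.1))
  rw [← hb, θ_ι, cls_e_mul_ι]

theorem pairing_unit : pairing k e (unitR k e) (unitL k e) = 1 := by
  change θ k e (cls k e e.1 * cls k e e.1) = 1
  rw [cls_mul, e.2.eq]
  have := θ_cls_incl k e 1
  rwa [incl_one] at this

end Units

/-! ### Generation of `Ind_J(V)` and separation of `Coind_J(V)` by `e` -/

section IndCoind

variable {k : Type u} [CommSemiring k] {S : Type v} [Semigroup S] {e : Idem S}
variable {V : Type w} [AddCommMonoid V] [Module k V] [RightModule k (kG k e) V]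

theorem Ind.act_tmul (v : V) (x : eA k e) (a : MonoidAlgebra k S) :
    act k (Ind.tmul k e V v x) a = Ind.tmul k e V v (rightS k e x a) :=
  Ind.actHom_tmul k e V v x a

theorem Coind.act_apply (f : Coind k e V) (a : MonoidAlgebra k S) (y : Ae k e) :
    (act k f a).1 y = f.1 (leftS k e a y) := rfl

theorem VC_tmul_apply (v : V) (x : eA k e) (y : Ae k e) :
    ((VC k e V).1 (Ind.tmul k e V v x)).1 y = act k v (pairing k e x y) := by
  change (Ind.lift (VC₁ k e V) (VC₁_act k e V) (Ind.tmul k e V v x)).1 y = _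
  rw [Ind.lift_tmul]
  rfl

variable (k e V) in
/-- The map `v ↦ v ⊗ e`. -/
noncomputable def unitTmul : V →ₗ[k] Ind k e V := (Ind.tmul k e V).flip (unitR k e)

theorem unitTmul_act (v : V) (b : kG k e) :
    unitTmul k e V (act k v b) = act k (unitTmul k e V v) (kincl k e b) := by
  change Ind.tmul k e V (act k v b) (unitR k e) = act k (Ind.tmul k e V v (unitR k e)) _
  rw [Ind.tmul_act, Ind.act_tmul, leftG_unitR]

theorem unitTmul_act_e (v : V) :
    act k (unitTmul k e V v) (MonoidAlgebra.single e.1 (1 : k)) = unitTmul k e V v := by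
  change act k (Ind.tmul k e V v (unitR k e)) _ = Ind.tmul k e V v (unitR k e)
  rw [Ind.act_tmul, rightS_unitR_e]

theorem Ind.exists_act_unitTmul (x : eA k e) :
    ∃ a : MonoidAlgebra k S, ∀ v, Ind.tmul k e V v x = act k (unitTmul k e V v) a := by
  obtain ⟨a, rfl⟩ := exists_rightS_unitR k e x
  exact ⟨a, fun v => (Ind.act_tmul v (unitR k e) a).symm⟩

theorem Ind.exists_unitTmul_eq [Finite S] (z : Ind k e V) :
    ∃ v, unitTmul k e V v = act k z (MonoidAlgebra.single e.1 (1 : k)) := by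
  induction z using Ind.induction with
  | h0 => exact ⟨0, by simp⟩
  | ha x y hx hy =>
    obtain ⟨v, hv⟩ := hx
    obtain ⟨w, hw⟩ := hy
    exact ⟨v + w, by rw [map_add, hv, hw, add_act]⟩
  | ht v x =>
    obtain ⟨b, hb⟩ := exists_rightS_e k e x
    exact ⟨act k v b, by rw [Ind.act_tmul, hb, ← Ind.tmul_act]; rfl⟩

/-- Every `y` in `A_J e` has the form `a e`, and `f(a e) = (f a)(e)`. -/
theorem Coind.ext_eval {f g : Coind k e V}
    (h : ∀ a : MonoidAlgebra k S, (act k f a).1 (unitL k e) = (act k g a).1 (unitL k e)) :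
    f = g := by
  refine Subtype.ext (LinearMap.ext fun y => ?_)
  obtain ⟨a, rfl⟩ := exists_leftS_unitL k e y
  exact h a

/-- Both sides send `y` to `f(e y)`, because `e y = e · C_J(e, y)` and `f` is `kG_e`-linear. -/
theorem Coind.act_e [Finite S] (f : Coind k e V) :
    act k f (MonoidAlgebra.single e.1 (1 : k)) = (VC k e V).1 (unitTmul k e V (f.1 (unitL k e))) := by
  refine Subtype.ext (LinearMap.ext fun y => ?_)
  rw [Coind.act_apply, leftS_e_eq, f.2]
  exact (VC_tmul_apply _ _ _).symm

theorem Coind.eval_act_e (f : Coind k e V) :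
    (act k f (MonoidAlgebra.single e.1 (1 : k))).1 (unitL k e) = f.1 (unitL k e) := by
  rw [Coind.act_apply]
  congr 1
  exact Subtype.ext (by
    change cls k e e.1 * cls k e e.1 = cls k e e.1
    rw [cls_mul, e.2.eq])

theorem Coind.eval_act_kincl (f : Coind k e V) (b : kG k e) :
    (act k f (kincl k e b)).1 (unitL k e) = act k (f.1 (unitL k e)) b := by
  rw [Coind.act_apply, ← rightG_unitL, f.2]

/-- `C_J(e, e) = 1`, and minimality makes `1` act as the identity although `V` is not assumed
unital. Hence `v ↦ VC(v ⊗ e)` is injective. -/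
theorem eval_VC_unitTmul (hV : IsMinimalMod k (kG k e) V) (v : V) :
    ((VC k e V).1 (unitTmul k e V v)).1 (unitL k e) = v := by
  refine (VC_tmul_apply _ _ _).trans ?_
  rw [pairing_unit, hV.act_one]

/-- The vector `v ⊗ e` is fixed by `e`, so its image is too, and `Coind.act_e` applies. -/
theorem RHom.map_unitTmul [Finite S]
    (φ : RHom k (MonoidAlgebra k S) (Ind k e V) (Coind k e V)) (v : V) :
    φ.1 (unitTmul k e V v)
      = (VC k e V).1 (unitTmul k e V ((φ.1 (unitTmul k e V v)).1 (unitL k e))) := by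
  rw [← Coind.act_e, ← φ.2, unitTmul_act_e]

theorem RHom.ext_unitTmul {P : Type*} [AddCommMonoid P] [Module k P]
    [RightModule k (MonoidAlgebra k S) P] {φ ψ : RHom k (MonoidAlgebra k S) (Ind k e V) P}
    (h : ∀ v, φ.1 (unitTmul k e V v) = ψ.1 (unitTmul k e V v)) : φ = ψ := by
  refine Subtype.ext (LinearMap.ext fun z => ?_)
  induction z using Ind.induction with
  | h0 => simp
  | ha x y hx hy => rw [map_add, map_add, hx, hy]
  | ht v x =>
    obtain ⟨a, ha⟩ := Ind.exists_act_unitTmul (V := V) x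
    rw [ha, φ.2, ψ.2, h]

/-- A submodule containing the images of all `v ⊗ e` contains the whole image. -/
theorem RSubmodule.map_mem_of_unitTmul {P : Type*} [AddCommMonoid P] [Module k P]
    [RightModule k (MonoidAlgebra k S) P] (Q : RSubmodule k (MonoidAlgebra k S) P)
    (φ : RHom k (MonoidAlgebra k S) (Ind k e V) P)
    (h : ∀ v, φ.1 (unitTmul k e V v) ∈ Q.toSubmodule) (z : Ind k e V) :
    φ.1 z ∈ Q.toSubmodule := by
  induction z using Ind.induction with
  | h0 => simp
  | ha x y hx hy => rw [map_add]; exact add_mem hx hy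
  | ht v x =>
    obtain ⟨a, ha⟩ := Ind.exists_act_unitTmul (V := V) x
    rw [ha, φ.2]
    exact Q.act_mem _ (h v) a

/-- The elements related to `0` are closed under sums and under the action, so every value of `φ` is
related to `0`, which serves in place of subtraction. -/
theorem RCon.rel_of_unitTmul {P : Type*} [AddCommMonoid P] [Module k P]
    [RightModule k (MonoidAlgebra k S) P] (R : RCon k (MonoidAlgebra k S) P)
    (φ : RHom k (MonoidAlgebra k S) (Ind k e V) P)
    (h : ∀ v, R.r (φ.1 (unitTmul k e V v)) 0) (z z' : Ind k e V) : R.r (φ.1 z) (φ.1 z') := by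
  have key : ∀ z, R.r (φ.1 z) 0 := fun z => by
    induction z using Ind.induction with
    | h0 => rw [map_zero]
    | ha x y hx hy =>
      have := R.add' hx hy
      rwa [add_zero, ← map_add] at this
    | ht v x =>
      obtain ⟨a, ha⟩ := Ind.exists_act_unitTmul (V := V) x
      rw [ha, φ.2]
      have := R.act a (h v)
      rwa [zero_act] at this
  exact R.iseqv.trans (key z) (R.iseqv.symm (key z'))

theorem VC_unitTmul_act (v : V) (b : kG k e) :
    (VC k e V).1 (unitTmul k e V (act k v b))
      = act k ((VC k e V).1 (unitTmul k e V v)) (kincl k e b) := by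
  rw [unitTmul_act, (VC k e V).2]

/-- Every nonzero submodule of `Coind_J(V)` contains the image of `V ⊗ C_J`. -/
theorem image_VC_le [Finite S] (hV : IsIrreducibleMod k (kG k e) V)
    (P : RSubmodule k (MonoidAlgebra k S) (Coind k e V)) {f : Coind k e V}
    (hf : f ∈ P.toSubmodule) (hne : f ≠ 0) : (image (VC k e V)).toSubmodule ≤ P.toSubmodule := by
  rintro _ ⟨z, rfl⟩
  obtain ⟨a, ha⟩ : ∃ a : MonoidAlgebra k S, (act k f a).1 (unitL k e) ≠ 0 := by
    by_contra! h
    exact hne (Coind.ext_eval fun a => by rw [h a, zero_act]; rfl)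
  refine P.map_mem_of_unitTmul (VC k e V) (fun v => ?_) z
  -- For `w = (f a)(e) ≠ 0`, the vector `f a e = VC(w ⊗ e)` lies in `P`; minimality of `V` passes
  -- this on to every `v`.
  refine hV.2.map_mem P ((VC k e V).1.comp (unitTmul k e V)) (kincl k e) VC_unitTmul_act ha ?_ v
  change (VC k e V).1 (unitTmul k e V _) ∈ _
  rw [← Coind.act_e]
  exact P.act_mem _ (P.act_mem _ hf _) _

end IndCoind


/-! ### Schur's lemma -/

section Modules

variable {k : Type*} {A : Type*} [CommSemiring k] [NonUnitalSemiring A] [Module k A]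
variable {M : Type*} [AddCommMonoid M] [Module k M] [RightModule k A M]
variable {N : Type*} [AddCommMonoid N] [Module k N] [RightModule k A N]

/-- The inclusion of a submodule. -/
def RSubmodule.incl (P : RSubmodule k A M) : RHom k A P.toSubmodule M :=
  ⟨P.toSubmodule.subtype, fun _ _ => rfl⟩

/-- The composite of two homomorphisms. -/
def RHom.comp {L : Type*} [AddCommMonoid L] [Module k L] [RightModule k A L]
    (g : RHom k A N L) (f : RHom k A M N) : RHom k A M L :=
  ⟨g.1.comp f.1, fun m a => by
    rw [LinearMap.comp_apply, LinearMap.comp_apply, f.2, g.2]⟩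

/-- Schur's lemma: a nonzero homomorphism from a simple module is injective. -/
theorem RHom.injective_of_ne_zero (hM : IsSimpleMod k A M) {f : RHom k A M N} (hf : f ≠ 0) :
    Function.Injective f.1 := by
  have hp : (RHom.ker f).IsProper := by
    by_contra h
    refine hf (Subtype.ext (LinearMap.ext fun m => ?_))
    by_contra hm
    refine h ⟨m, 0, fun h0 => hm ?_⟩
    exact (show f.1 m = f.1 0 from h0).trans (map_zero _)
  exact fun m m' h => hM.2 _ hp m m' h

end Modules

/-! ### Irreducibility of the image, and the socle -/

section Image

variable {k : Type u} [CommSemiring k] {S : Type v} [Semigroup S] {e : Idem S}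
variable {V : Type w} [AddCommMonoid V] [Module k V] [RightModule k (kG k e) V]

theorem VC_unitTmul_ne_zero (hV : IsMinimalMod k (kG k e) V) {v : V} (hv : v ≠ 0) :
    (VC k e V).1 (unitTmul k e V v) ≠ 0 := fun h => by
  have := eval_VC_unitTmul hV v
  rw [h] at this
  exact hv this.symm

theorem VC_unitTmul_act_e (v : V) :
    act k ((VC k e V).1 (unitTmul k e V v)) (MonoidAlgebra.single e.1 (1 : k))
      = (VC k e V).1 (unitTmul k e V v) := by
  rw [← (VC k e V).2, unitTmul_act_e]

theorem VC_ne_zero (hV : IsMinimalMod k (kG k e) V) : VC k e V ≠ 0 := fun h => by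
  obtain ⟨v, hv⟩ := hV.1.exists_ne_zero
  exact VC_unitTmul_ne_zero hV hv (by rw [h]; rfl)

theorem image_VC_isMinimalMod [Finite S] (hV : IsIrreducibleMod k (kG k e) V) :
    IsMinimalMod k (MonoidAlgebra k S) (image (VC k e V)).toSubmodule := by
  constructor
  · obtain ⟨v, hv⟩ := hV.2.1.exists_ne_zero
    refine ⟨⟨_, unitTmul k e V v, rfl⟩, MonoidAlgebra.single e.1 (1 : k), fun h => ?_⟩
    exact VC_unitTmul_ne_zero hV.2 hv ((VC_unitTmul_act_e v).symm.trans (congrArg Subtype.val h))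
  · intro P
    refine or_iff_not_imp_left.2 fun hP => ?_
    obtain ⟨f, hf, hne⟩ := Submodule.exists_mem_ne_zero_of_ne_bot hP
    -- `P` is a submodule of the image; composing the two inclusions turns it into a submodule of
    -- `Coind_J(V)`.
    have hle := image_VC_le hV (image (RHom.comp (image (VC k e V)).incl P.incl)) (f := f.1)
      ⟨⟨f, hf⟩, rfl⟩ (fun h => hne (Subtype.ext h))
    refine (Submodule.eq_top_iff').2 fun g => ?_
    obtain ⟨g', hg'⟩ := hle g.2
    have : g'.1 = g := Subtype.ext hg'
    exact this ▸ g'.2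

theorem image_VC_isSimpleMod [Finite S] (hV : IsIrreducibleMod k (kG k e) V) :
    IsSimpleMod k (MonoidAlgebra k S) (image (VC k e V)).toSubmodule := by
  refine ⟨(image_VC_isMinimalMod hV).1, fun R ⟨m, m', hR⟩ f g hfg => ?_⟩
  by_contra hne
  obtain ⟨a, ha⟩ : ∃ a : MonoidAlgebra k S,
      (act k f.1 a).1 (unitL k e) ≠ (act k g.1 a).1 (unitL k e) := by
    by_contra! h
    exact hne (Subtype.ext (Coind.ext_eval h))
  -- `R` lives on the image only, so `VC` is corestricted before `R` is pulled back to `V`.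
  let c : RHom k (MonoidAlgebra k S) (Ind k e V) (image (VC k e V)).toSubmodule :=
    ⟨(VC k e V).1.rangeRestrict, fun z a => Subtype.ext ((VC k e V).2 z a)⟩
  have hc : ∀ v b, c.1 (unitTmul k e V (act k v b))
      = act k (c.1 (unitTmul k e V v)) (kincl k e b) :=
    fun v b => Subtype.ext (VC_unitTmul_act v b)
  have he : ∀ f : (image (VC k e V)).toSubmodule,
      act k (act k f a) (MonoidAlgebra.single e.1 (1 : k))
        = c.1 (unitTmul k e V ((act k f.1 a).1 (unitL k e))) :=
    fun f => Subtype.ext (Coind.act_e (act k f.1 a))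
  have h1 := R.act (MonoidAlgebra.single e.1 (1 : k)) (R.act a hfg)
  rw [he, he] at h1
  -- The values of `f a` and `g a` at `e` are distinct elements of `V` whose images under `v ↦ c(v ⊗
  -- e)` are related, so all such images are related.
  have h2 := hV.1.rel_map R (c.1.comp (unitTmul k e V)) (kincl k e) hc ha h1
  obtain ⟨z, hz⟩ := m.2
  obtain ⟨z', hz'⟩ := m'.2
  refine hR ?_
  have := R.rel_of_unitTmul c (fun v => by simpa using h2 v 0) z z'
  rwa [show c.1 z = m from Subtype.ext hz, show c.1 z' = m' from Subtype.ext hz'] at this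

/-- A minimal submodule contains the image of `VC` by `image_VC_le`, and by its own minimality is no
larger. -/
theorem socle_Coind [Finite S] (hV : IsIrreducibleMod k (kG k e) V) :
    socle k (MonoidAlgebra k S) (Coind k e V) = (image (VC k e V)).toSubmodule := by
  refine le_antisymm (iSup₂_le fun P hP => ?_)
    (le_iSup₂_of_le (image (VC k e V)) (image_VC_isMinimalMod hV) le_rfl)
  obtain ⟨f, hf⟩ := hP.1.exists_ne_zero
  have hle := image_VC_le hV P f.2 (fun h => hf (Subtype.ext h))
  obtain ⟨v, hv⟩ := hV.2.1.exists_ne_zero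
  have hmem : (VC k e V).1 (unitTmul k e V v) ∈ (image (VC k e V)).toSubmodule := ⟨_, rfl⟩
  intro g hg
  exact hP.map_mem (image (VC k e V)) P.incl.1 id P.incl.2
    (m := ⟨_, hle hmem⟩) (fun h => VC_unitTmul_ne_zero hV.2 hv (congrArg Subtype.val h))
    hmem ⟨g, hg⟩

end Image

/-! ### Homomorphisms from `Ind_J(V)` to `Coind_J(V)`, and the radical -/

section HomIndCoind

variable {k : Type u} [CommSemiring k] {S : Type v} [Semigroup S] {e : Idem S}
variable {V : Type w} [AddCommMonoid V] [Module k V] [RightModule k (kG k e) V]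

variable (k e V) in
/-- The map `φ ↦ (v ↦ φ(v ⊗ e)(e))`. -/
noncomputable def evalHom :
    RHom k (MonoidAlgebra k S) (Ind k e V) (Coind k e V) →ₗ[k] RHom k (kG k e) V V where
  toFun φ :=
    ⟨{ toFun := fun v => (φ.1 (unitTmul k e V v)).1 (unitL k e)
       map_add' := fun v w => by rw [map_add, map_add]; rfl
       map_smul' := fun c v => by rw [map_smul, map_smul]; rfl }, fun v b => by
      change (φ.1 (unitTmul k e V (act k v b))).1 (unitL k e) = _
      rw [unitTmul_act, φ.2, Coind.eval_act_kincl]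
      rfl⟩
  map_add' _ _ := rfl
  map_smul' _ _ := rfl

/-- By `RHom.map_unitTmul`, `φ(v ⊗ e)` is determined by its value at `e`, and the vectors `v ⊗ e`
generate. -/
theorem evalHom_injective [Finite S] : Function.Injective (evalHom k e V) := fun φ ψ h => by
  refine RHom.ext_unitTmul fun v => ?_
  rw [RHom.map_unitTmul φ, RHom.map_unitTmul ψ]
  have : (evalHom k e V φ).1 v = (evalHom k e V ψ).1 v := by rw [h]
  exact congrArg (fun v => (VC k e V).1 (unitTmul k e V v)) this

/-- The homomorphism `v ⊗ x ↦ h(v) ⊗ x`. -/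
noncomputable def Ind.map (h : RHom k (kG k e) V V) :
    RHom k (MonoidAlgebra k S) (Ind k e V) (Ind k e V) :=
  ⟨Ind.lift ((Ind.tmul k e V).comp h.1) (fun v b x => by
      rw [LinearMap.comp_apply, LinearMap.comp_apply, h.2, Ind.tmul_act]), fun z a => by
    induction z using Ind.induction with
    | h0 => simp
    | ha x y hx hy => rw [add_act, map_add, map_add, hx, hy, add_act]
    | ht v x =>
      rw [Ind.act_tmul, Ind.lift_tmul, Ind.lift_tmul]
      exact (Ind.act_tmul _ _ _).symm⟩

theorem Ind.map_tmul (h : RHom k (kG k e) V V) (v : V) (x : eA k e) :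
    (Ind.map h).1 (Ind.tmul k e V v x) = Ind.tmul k e V (h.1 v) x := by
  simp [Ind.map]

/-- A preimage of `h` is `VC` composed with `v ⊗ x ↦ h(v) ⊗ x`. -/
theorem evalHom_surjective (hV : IsMinimalMod k (kG k e) V) :
    Function.Surjective (evalHom k e V) := fun h => by
  refine ⟨RHom.comp (VC k e V) (Ind.map h), Subtype.ext (LinearMap.ext fun v => ?_)⟩
  have : (Ind.map h).1 (unitTmul k e V v) = unitTmul k e V (h.1 v) :=
    Ind.map_tmul h v (unitR k e)
  change ((VC k e V).1 ((Ind.map h).1 (unitTmul k e V v))).1 (unitL k e) = _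
  rw [this, eval_VC_unitTmul hV]

theorem image_eq_image_VC [Finite S] (hV : IsIrreducibleMod k (kG k e) V)
    {φ : RHom k (MonoidAlgebra k S) (Ind k e V) (Coind k e V)} (hφ : φ ≠ 0) :
    (image φ).toSubmodule = (image (VC k e V)).toSubmodule := by
  refine le_antisymm ?_ ?_
  · rintro _ ⟨z, rfl⟩
    refine (image (VC k e V)).map_mem_of_unitTmul φ (fun v => ?_) z
    rw [RHom.map_unitTmul φ]
    exact ⟨_, rfl⟩
  · obtain ⟨z, hz⟩ : ∃ z, φ.1 z ≠ 0 := by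
      by_contra! h
      exact hφ (Subtype.ext (LinearMap.ext h))
    exact image_VC_le hV (image φ) ⟨z, rfl⟩ hz

/-- Every proper congruence on `Ind_J(V)` is contained in the kernel congruence of every
homomorphism to `Coind_J(V)`. -/
theorem RCon.le_ker [Finite S] (hV : IsSimpleMod k (kG k e) V)
    {R : RCon k (MonoidAlgebra k S) (Ind k e V)} (hR : R.IsProper)
    (φ : RHom k (MonoidAlgebra k S) (Ind k e V) (Coind k e V)) {z z' : Ind k e V}
    (h : R.r z z') : φ.1 z = φ.1 z' := by
  refine Coind.ext_eval fun a => ?_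
  obtain ⟨v, hv⟩ := Ind.exists_unitTmul_eq (SgpRep.act k z a)
  obtain ⟨v', hv'⟩ := Ind.exists_unitTmul_eq (SgpRep.act k z' a)
  have h1 := R.act (MonoidAlgebra.single e.1 (1 : k)) (R.act a h)
  rw [← hv, ← hv'] at h1
  -- Here `z a e = v ⊗ e` and `z' a e = v' ⊗ e` are related by `R`. If `v ≠ v'`, simplicity of `V`
  -- relates all `v ⊗ e` to `0`, and `R` is universal.
  have hvv : v = v' := by
    by_contra hne
    obtain ⟨x, y, hxy⟩ := hR
    have h2 := hV.rel_map R (unitTmul k e V) (kincl k e) unitTmul_act hne h1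
    exact hxy (R.rel_of_unitTmul ⟨LinearMap.id, fun _ _ => rfl⟩
      (fun v => by simpa using h2 v 0) x y)
  -- Multiplying by `e` does not change the value at `e`, so `φ(z a e) = φ(z' a e)` suffices.
  rw [← Coind.eval_act_e (SgpRep.act k (φ.1 z) a), ← Coind.eval_act_e (SgpRep.act k (φ.1 z') a),
    ← φ.2, ← φ.2, ← φ.2, ← φ.2, ← hv, ← hv', hvv]

/-- By `RCon.le_ker` the kernel is the greatest proper congruence, hence the only maximal one. -/
theorem ker_iff_radical [Finite S] (hV : IsSimpleMod k (kG k e) V)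
    {φ : RHom k (MonoidAlgebra k S) (Ind k e V) (Coind k e V)} (hφ : φ ≠ 0) (x y : Ind k e V) :
    φ.1 x = φ.1 y ↔ radical k (MonoidAlgebra k S) (Ind k e V) x y := by
  have hp : (RHom.ker φ).IsProper := by
    by_contra h
    refine hφ (Subtype.ext (LinearMap.ext fun m => ?_))
    by_contra hm
    exact h ⟨m, 0, fun h0 => hm ((show φ.1 m = φ.1 0 from h0).trans (map_zero _))⟩
  constructor
  · intro h R hR
    exact hR.2 (RHom.ker φ) hp (fun m m' hm => RCon.le_ker hV hR.1 φ hm) x y h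
  · intro h
    exact h (RHom.ker φ) ⟨hp, fun R hR _ m m' hm => RCon.le_ker hV hR φ hm⟩

end HomIndCoind

/-! ### The apex of the image, and its restriction to `G_e` -/

section Apex

variable {k : Type u} [CommSemiring k] {S : Type v} [Semigroup S] {e : Idem S}

theorem kincl_mul_e (b : kG k e) :
    kincl k e b * MonoidAlgebra.single e.1 (1 : k) = kincl k e b := by
  induction b using MonoidAlgebra.induction_linear with
  | zero => simp
  | add x y hx hy => rw [map_add, add_mul, hx, hy]
  | single g r => simp [kincl_single, incl_mul_e]

theorem e_mul_kincl (b : kG k e) :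
    MonoidAlgebra.single e.1 (1 : k) * kincl k e b = kincl k e b := by
  induction b using MonoidAlgebra.induction_linear with
  | zero => simp
  | add x y hx hy => rw [map_add, mul_add, hx, hy]
  | single g r => simp [kincl_single, e_mul_incl]

/-- A linear map on `kS` that vanishes on the elements not above `J` factors through `A_J`. -/
noncomputable def AJ.lift {P : Type*} [AddCommMonoid P] [Module k P]
    (F : MonoidAlgebra k S →ₗ[k] P)
    (hF : ∀ s ∈ notAbove (jClass e.1), F (MonoidAlgebra.single s 1) = 0) : AJ k e →ₗ[k] P where
  toFun := Quotient.lift F (by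
    have h0 : ∀ n ∈ kNotAbove k e, F n = 0 := fun n hn => by
      have : kNotAbove k e ≤ LinearMap.ker F := by
        refine Submodule.span_le.2 ?_
        rintro _ ⟨s, hs, rfl⟩
        exact hF s hs
      exact this hn
    rintro a b ⟨n, hn, n', hn', h⟩
    have := congrArg F h
    rwa [map_add, map_add, h0 n hn, h0 n' hn', add_zero, add_zero] at this)
  map_add' x y := by
    obtain ⟨a, rfl⟩ := proj_surjective k e x
    obtain ⟨b, rfl⟩ := proj_surjective k e y
    exact map_add F a b
  map_smul' c x := by
    obtain ⟨a, rfl⟩ := proj_surjective k e x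
    exact map_smul F c a

/-- Elements not above `J` vanish in `A_J`, so they annihilate. If an annihilating `s` had `e = x s
y`, then `e` would annihilate too, yet it fixes a nonzero `VC(v ⊗ e)`. -/
theorem image_VC_hasApex [Finite S] {V : Type w} [AddCommMonoid V] [Module k V]
    [RightModule k (kG k e) V] (hV : IsIrreducibleMod k (kG k e) V) :
    HasApex k (image (VC k e V)).toSubmodule (jClass e.1) := by
  refine ⟨⟨e, rfl⟩, Set.ext fun s => ⟨fun hs => ?_, fun hs f => ?_⟩⟩
  · by_contra h
    rw [mem_notAbove_iff, not_not] at h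
    obtain ⟨x, y, hxy⟩ := h
    obtain ⟨v, hv⟩ := hV.2.1.exists_ne_zero
    -- Quantified over `m`, because a factor `x` on the left of `s` replaces `m` by `m x`.
    have hkill : ∀ m : (image (VC k e V)).toSubmodule, ∀ y : WithOne S, ∀ t : S,
        (t : WithOne S) = s * y → act k m (MonoidAlgebra.single t (1 : k)) = 0 := by
      intro m y t ht
      cases y with
      | one =>
        rw [mul_one] at ht
        rw [WithOne.coe_injective ht]
        exact hs m
      | coe y =>
        rw [← WithOne.coe_mul] at ht
        rw [WithOne.coe_injective ht, ← one_mul (1 : k), ← MonoidAlgebra.single_mul_single,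
          act_mul, hs m, zero_act]
    let m : (image (VC k e V)).toSubmodule := ⟨_, unitTmul k e V v, rfl⟩
    have h0 : act k m (MonoidAlgebra.single e.1 (1 : k)) = 0 := by
      cases x with
      | one => exact hkill m y e.1 (by rw [hxy, one_mul])
      | coe x =>
        have hy : ∃ t : S, (t : WithOne S) = s * y := by
          cases y with
          | one => exact ⟨s, by simp⟩
          | coe y => exact ⟨s * y, by simp⟩
        obtain ⟨t, ht⟩ := hy
        rw [mul_assoc, ← ht, ← WithOne.coe_mul] at hxy
        rw [WithOne.coe_injective hxy, ← one_mul (1 : k), ← MonoidAlgebra.single_mul_single,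
          act_mul]
        exact hkill _ y t ht
    exact VC_unitTmul_ne_zero hV.2 hv ((VC_unitTmul_act_e v).symm.trans (congrArg Subtype.val h0))
  · refine Subtype.ext (Subtype.ext (LinearMap.ext fun y => ?_))
    change f.1.1 (leftS k e (MonoidAlgebra.single s (1 : k)) y) = 0
    have : leftS k e (MonoidAlgebra.single s (1 : k)) y = 0 := Subtype.ext (by
      change cls k e s * y.1 = 0
      rw [cls_of_mem_notAbove k e hs, zero_mul])
    rw [this, map_zero]

/-- The isomorphism is evaluation at `e`, with inverse `v ↦ VC(v ⊗ e)` by `Coind.act_e`. -/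
theorem image_VC_res [Finite S] {V : Type w} [AddCommMonoid V] [Module k V]
    [RightModule k (kG k e) V] (hV : IsMinimalMod k (kG k e) V) :
    RIso k (kG k e) (Res k (image (VC k e V)).toSubmodule e) V := by
  let ev : Res k (image (VC k e V)).toSubmodule e →ₗ[k] V :=
    { toFun := fun f => f.1.1.1 (unitL k e)
      map_add' := fun _ _ => rfl
      map_smul' := fun _ _ => rfl }
  have hev : ∀ f, f.1.1 = (VC k e V).1 (unitTmul k e V (ev f)) := by
    rintro ⟨_, f, rfl⟩
    refine (Coind.act_e f.1).trans ?_
    congr 2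
    exact (Coind.eval_act_e f.1).symm
  refine ⟨LinearEquiv.ofBijective ev ⟨fun f g h => ?_, fun v => ?_⟩, fun f b => ?_⟩
  · exact Subtype.ext (Subtype.ext (by rw [hev, hev, h]))
  · refine ⟨⟨⟨_, unitTmul k e V v, rfl⟩, ⟨_, unitTmul k e V v, rfl⟩, ?_⟩, ?_⟩
    · exact Subtype.ext (VC_unitTmul_act_e v)
    · exact eval_VC_unitTmul hV v
  · exact Coind.eval_act_kincl f.1.1 b

end Apex

/-! ### Uniqueness of the irreducible module corresponding to `V` -/

section Uniqueness

variable {k : Type u} [CommSemiring k] {S : Type v} [Semigroup S] {e : Idem S}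
variable {V : Type w} [AddCommMonoid V] [Module k V] [RightModule k (kG k e) V]
variable {M : Type x} [AddCommMonoid M] [Module k M] [RightModule k (MonoidAlgebra k S) M]

variable (k e M) in
/-- The bilinear map `(m, a) ↦ m a e`. -/
noncomputable def actRes : M →ₗ[k] MonoidAlgebra k S →ₗ[k] Res k M e :=
  LinearMap.mk₂ k
    (fun m a => ⟨act k (act k m a) (MonoidAlgebra.single e.1 (1 : k)), act k m a, rfl⟩)
    (fun _ _ _ => Subtype.ext (by simp only [add_act]; rfl))
    (fun _ _ _ => Subtype.ext (by simp only [smul_act]; rfl))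
    (fun _ _ _ => Subtype.ext (by simp only [act_add, add_act]; rfl))
    (fun _ _ _ => Subtype.ext (by simp only [act_smul, smul_act]; rfl))

theorem actRes_mul (m : M) (a b : MonoidAlgebra k S) :
    actRes k e M m (a * b) = actRes k e M (act k m a) b :=
  Subtype.ext (congrArg (fun m => act k m _) (act_mul m a b))

/-- `e` is a two-sided identity for `kG_e`, so both sides equal `m a b`. -/
theorem actRes_kincl (m : M) (a : MonoidAlgebra k S) (b : kG k e) :
    actRes k e M m (a * kincl k e b) = act k (actRes k e M m a) b := by
  refine Subtype.ext ?_
  change act k (act k m (a * kincl k e b)) _ = act k (act k (act k m a) _) (kincl k e b)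
  rw [← act_mul, ← act_mul, ← act_mul, mul_assoc, kincl_mul_e, e_mul_kincl]

theorem actRes_e (m : M) : actRes k e M m (MonoidAlgebra.single e.1 (1 : k))
    = ⟨act k m (MonoidAlgebra.single e.1 (1 : k)), m, rfl⟩ :=
  Subtype.ext (by
    change act k (act k m _) _ = act k m _
    rw [← act_mul, MonoidAlgebra.single_mul_single, e.2.eq, one_mul])

/-- The homomorphism `m ↦ (y ↦ ψ(m y))` to `Coind_J(V)` determined by `ψ : M e → V`. -/
noncomputable def toCoind (hM : notAbove (jClass e.1) ⊆ ann k S M)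
    (ψ : RHom k (kG k e) (Res k M e) V) : RHom k (MonoidAlgebra k S) M (Coind k e V) :=
  have h : ∀ m, ∀ s ∈ notAbove (jClass e.1),
      (ψ.1.comp (actRes k e M m)) (MonoidAlgebra.single s 1) = 0 := fun m s hs => by
    have : actRes k e M m (MonoidAlgebra.single s 1) = 0 := Subtype.ext (by
      change act k (act k m _) _ = 0
      rw [hM hs m, zero_act])
    rw [LinearMap.comp_apply, this, map_zero]
  ⟨{ toFun := fun m =>
      ⟨(AJ.lift (ψ.1.comp (actRes k e M m)) (h m)).comp (Ae k e).subtype, by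
        rintro ⟨y, hy⟩ b
        obtain ⟨a, rfl⟩ := proj_surjective k e y
        change ψ.1 (actRes k e M m (a * kincl k e b)) = act k (ψ.1 (actRes k e M m a)) b
        rw [actRes_kincl, ψ.2]⟩
     map_add' := fun m m' => Subtype.ext (LinearMap.ext fun ⟨y, hy⟩ => by
      obtain ⟨a, rfl⟩ := proj_surjective k e y
      change ψ.1 (actRes k e M (m + m') a)
        = ψ.1 (actRes k e M m a) + ψ.1 (actRes k e M m' a)
      rw [map_add, LinearMap.add_apply, map_add])
     map_smul' := fun c m => Subtype.ext (LinearMap.ext fun ⟨y, hy⟩ => by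
      obtain ⟨a, rfl⟩ := proj_surjective k e y
      change ψ.1 (actRes k e M (c • m) a) = c • ψ.1 (actRes k e M m a)
      rw [map_smul, LinearMap.smul_apply, map_smul]) }, fun m a =>
    Subtype.ext (LinearMap.ext fun ⟨y, hy⟩ => by
      obtain ⟨b, rfl⟩ := proj_surjective k e y
      change ψ.1 (actRes k e M (act k m a) b) = ψ.1 (actRes k e M m (a * b))
      rw [actRes_mul])⟩

/-- An element of `M e` is `m' e`, and `m'` is sent to a map with value `ψ(m' e)` at `e`. So the
homomorphism is nonzero once `ψ` is. -/
theorem toCoind_eval (hM : notAbove (jClass e.1) ⊆ ann k S M)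
    (ψ : RHom k (kG k e) (Res k M e) V) (m : Res k M e) :
    ∃ m', ((toCoind hM ψ).1 m').1 (unitL k e) = ψ.1 m := by
  obtain ⟨_, m, rfl⟩ := m
  exact ⟨m, congrArg ψ.1 (actRes_e m)⟩

/-- The uniqueness of the irreducible module corresponding to `V`. -/
theorem Corresponds.rIso [Finite S] (hV : IsIrreducibleMod k (kG k e) V)
    (hM : Corresponds k M e V) :
    RIso k (MonoidAlgebra k S) M (image (VC k e V)).toSubmodule := by
  obtain ⟨hirr, hapex, ψ, hψ⟩ := hM
  let Ψ := toCoind (M := M) hapex.2.ge ⟨ψ.toLinearMap, hψ⟩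
  obtain ⟨v, hv⟩ := hV.2.1.exists_ne_zero
  obtain ⟨m, hm⟩ := toCoind_eval (M := M) hapex.2.ge ⟨ψ.toLinearMap, hψ⟩ (ψ.symm v)
  have hm0 : Ψ.1 m ≠ 0 := fun h => hv <| by
    have h1 : (Ψ.1 m).1 (unitL k e) = v := hm.trans (ψ.apply_symm_apply v)
    rw [← h1, h]
    rfl
  have hinj := RHom.injective_of_ne_zero (f := Ψ) hirr.1 (fun h => hm0 (by rw [h]; rfl))
  have hle : (image (VC k e V)).toSubmodule ≤ LinearMap.range Ψ.1 :=
    image_VC_le hV (image Ψ) ⟨m, rfl⟩ hm0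
  have heq : LinearMap.range Ψ.1 = (image (VC k e V)).toSubmodule := by
    refine le_antisymm ?_ hle
    have hmem : (VC k e V).1 (unitTmul k e V v) ∈ (image (VC k e V)).toSubmodule := ⟨_, rfl⟩
    obtain ⟨n, hn⟩ := hle hmem
    rintro _ ⟨p, rfl⟩
    -- The preimage of the image of `VC` contains `n ≠ 0`, hence all of `M` by minimality.
    refine hirr.2.map_mem (image (VC k e V)) Ψ.1 id Ψ.2 (m := n) ?_ (by rw [hn]; exact hmem) p
    rintro rfl
    rw [map_zero] at hn
    exact VC_unitTmul_ne_zero hV.2 hv hn.symm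
  exact ⟨(LinearEquiv.ofInjective Ψ.1 hinj).trans (LinearEquiv.ofEq _ _ heq),
    fun m a => Subtype.ext (Ψ.2 m a)⟩

end Uniqueness


/-! ### Factoring elements of `J` through `G_e` -/

section Green

variable {S : Type v} [Semigroup S] {e : Idem S}

theorem exists_mul_eq_of_mem_lClass {t : S} (ht : t ∈ lClass e.1) :
    ∃ x : WithOne S, (e.1 : WithOne S) = x * t := by
  have ht' : principalLeft t = principalLeft e.1 := ht
  have : e.1 ∈ principalLeft t := by
    rw [ht']
    exact ⟨1, by simp⟩
  exact this

theorem mul_incl_mem_jClass {t : S} (ht : t ∈ lClass e.1) (g : MaxSubgroup e) :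
    t * incl e g ∈ jClass e.1 := by
  obtain ⟨x, hx⟩ := exists_mul_eq_of_mem_lClass ht
  refine mem_jClass_of_mem e ⟨x, (incl e g⁻¹ : S), ?_⟩ ?_
  · rw [mul_assoc x, ← WithOne.coe_mul, mul_assoc t, incl_mul_inv,
      mul_e_of_mem_lClass e ht, hx]
  · rw [← incl_mul_e e g, ← mul_assoc]
    exact mem_principalIdeal_mul_right _ _

/-- Right multiplication by `g` is undone by `g⁻¹`, as `t e = t`. -/
theorem mem_rClass_mul_incl {t : S} (ht : t ∈ lClass e.1) (g : MaxSubgroup e) :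
    t ∈ rClass (t * incl e g) := by
  refine Set.ext fun s => ⟨?_, ?_⟩
  · rintro ⟨y, hy⟩
    refine ⟨(incl e g⁻¹ : S) * y, ?_⟩
    rw [hy, ← mul_assoc, ← WithOne.coe_mul, mul_assoc t, incl_mul_inv, mul_e_of_mem_lClass e ht]
  · rintro ⟨y, hy⟩
    exact ⟨(incl e g : S) * y, by rw [hy, WithOne.coe_mul, mul_assoc]⟩

/-- Multiply on the left by `x` with `x t = e`. -/
theorem mul_incl_cancel {t : S} (ht : t ∈ lClass e.1) {g h : MaxSubgroup e}
    (hgh : t * incl e g = t * incl e h) : g = h := by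
  obtain ⟨x, hx⟩ := exists_mul_eq_of_mem_lClass ht
  refine incl_injective e (WithOne.coe_injective ?_)
  rw [← e_mul_incl e g, ← e_mul_incl e h, WithOne.coe_mul, WithOne.coe_mul, hx, mul_assoc,
    mul_assoc, ← WithOne.coe_mul, ← WithOne.coe_mul, hgh]

/-- In a finite semigroup, two elements of `J_e ∩ S e` in the same `ℛ`-class differ by an element
of `G_e`. -/
theorem exists_eq_mul_incl [Finite S] {s t : S} (hs : s ∈ jClass e.1) (hse : s * e.1 = s)
    (ht : t ∈ lClass e.1) (hts : t ∈ rClass s) : ∃ g, s = t * incl e g := by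
  have hts' : principalRight t = principalRight s := hts
  have hte := mul_e_of_mem_lClass e ht
  have hmem : s ∈ principalRight t := by
    rw [hts']
    exact ⟨1, by simp⟩
  obtain ⟨y, hy⟩ := hmem
  obtain ⟨u, hu⟩ : ∃ u : S, s = t * u := by
    cases y with
    | one => exact ⟨e.1, by rw [hte]; exact WithOne.coe_injective (by rw [hy, mul_one])⟩
    | coe y => exact ⟨y, WithOne.coe_injective (by rw [hy, WithOne.coe_mul])⟩
  -- Replacing `u` by `e u e` changes nothing, as `t e = t` and `s e = s`. The new factor is
  -- `𝒥`-above `s` and below `e`, so it lies in `eSe ∩ J = G_e`.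
  have hu' : s = t * (e.1 * u * e.1) := by
    rw [← mul_assoc, ← mul_assoc, hte, ← hu, hse]
  have h1 : s ∈ principalIdeal (e.1 * u * e.1) := by
    rw [hu']
    exact mem_principalIdeal_mul_right _ _
  obtain ⟨g, hg⟩ := exists_incl_eq e (s := e.1 * u * e.1)
    (by simp only [← mul_assoc, e.2.eq]) (by rw [mul_assoc, e.2.eq])
    (mem_jClass_of_mem e (principalIdeal_trans (mem_principalIdeal_of_mem_jClass e hs) h1)
      (mem_principalIdeal_mul_right _ _))
  exact ⟨g, by rw [hg, ← hu']⟩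

/-- In a finite semigroup, two elements of `J_e ∩ e S` in the same `ℒ`-class differ by an element
of `G_e`. -/
theorem exists_eq_incl_mul [Finite S] {s t : S} (hs : s ∈ jClass e.1) (hes : e.1 * s = s)
    (ht : t ∈ rClass e.1) (hts : t ∈ lClass s) : ∃ g, s = incl e g * t := by
  have hts' : principalLeft t = principalLeft s := hts
  have het := e_mul_of_mem_rClass e ht
  have hmem : s ∈ principalLeft t := by
    rw [hts']
    exact ⟨1, by simp⟩
  obtain ⟨y, hy⟩ := hmem
  obtain ⟨u, hu⟩ : ∃ u : S, s = u * t := by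
    cases y with
    | one => exact ⟨e.1, by rw [het]; exact WithOne.coe_injective (by rw [hy, one_mul])⟩
    | coe y => exact ⟨y, WithOne.coe_injective (by rw [hy, WithOne.coe_mul])⟩
  have hu' : s = e.1 * u * e.1 * t := by
    rw [mul_assoc, het, mul_assoc, ← hu, hes]
  have h1 : s ∈ principalIdeal (e.1 * u * e.1) := by
    rw [hu']
    exact mem_principalIdeal_mul_left _ _
  obtain ⟨g, hg⟩ := exists_incl_eq e (s := e.1 * u * e.1)
    (by simp only [← mul_assoc, e.2.eq]) (by rw [mul_assoc, e.2.eq])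
    (mem_jClass_of_mem e (principalIdeal_trans (mem_principalIdeal_of_mem_jClass e hs) h1)
      (mem_principalIdeal_mul_right _ _))
  exact ⟨g, by rw [hg, ← hu']⟩

end Green

/-! ### Coordinates and the sandwich matrix -/

section Coordinates

variable {k : Type u} [CommSemiring k] {S : Type v} [Semigroup S] {e : Idem S}
variable {V : Type w} [AddCommMonoid V] [Module k V] [RightModule k (kG k e) V]
variable {T T' : Set S}

/-- Either `s e` vanishes in `A_J`, or it lies in `J` and is `t g` for the representative `t` of its
`ℛ`-class. So `T'` generates `A_J e` over `kG_e`. -/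
theorem IsRTransversal.leftS_single [Finite S] (hT' : IsRTransversal e T') (s : S) (r : k) :
    leftS k e (MonoidAlgebra.single s r) (unitL k e) = 0 ∨
      ∃ (t : T') (g : MaxSubgroup e), leftS k e (MonoidAlgebra.single s r) (unitL k e)
        = rightG k e (ofL k e ⟨t.1, hT'.1 t.2⟩) (MonoidAlgebra.single g r) := by
  have key : (leftS k e (MonoidAlgebra.single s r) (unitL k e)).1 = r • cls k e (s * e.1) := by
    change proj k e (MonoidAlgebra.single s r) * cls k e e.1 = _
    rw [← cls_mul, ← smul_mul_assoc, cls, cls, ← map_smul]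
    simp
  by_cases h : s * e.1 ∈ notAbove (jClass e.1)
  · left
    exact Subtype.ext (by rw [key, cls_of_mem_notAbove k e h, smul_zero]; rfl)
  · right
    rw [mem_notAbove_iff, not_not] at h
    have hj := mem_jClass_of_mem e h (mem_principalIdeal_mul_right _ _)
    obtain ⟨t, ⟨ht, hts⟩, -⟩ := hT'.2 _ hj
    obtain ⟨g, hg⟩ := exists_eq_mul_incl hj (by rw [mul_assoc, e.2.eq]) (hT'.1 ht) hts
    refine ⟨⟨t, ht⟩, g, Subtype.ext (key.trans ?_)⟩
    change _ = cls k e t * ι k e _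
    rw [ι_single, mul_smul_comm, cls_mul, hg]

theorem IsLTransversal.rightS_single [Finite S] (hT : IsLTransversal e T) (s : S) (r : k) :
    rightS k e (unitR k e) (MonoidAlgebra.single s r) = 0 ∨
      ∃ (t : T) (g : MaxSubgroup e), rightS k e (unitR k e) (MonoidAlgebra.single s r)
        = leftG k e (MonoidAlgebra.single g r) (ofR k e ⟨t.1, hT.1 t.2⟩) := by
  have key : (rightS k e (unitR k e) (MonoidAlgebra.single s r)).1 = r • cls k e (e.1 * s) := by
    change cls k e e.1 * proj k e (MonoidAlgebra.single s r) = _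
    rw [← cls_mul, ← mul_smul_comm, cls, cls, ← map_smul]
    simp
  by_cases h : e.1 * s ∈ notAbove (jClass e.1)
  · left
    exact Subtype.ext (by rw [key, cls_of_mem_notAbove k e h, smul_zero]; rfl)
  · right
    rw [mem_notAbove_iff, not_not] at h
    have hj := mem_jClass_of_mem e h (mem_principalIdeal_mul_left _ _)
    obtain ⟨t, ⟨ht, hts⟩, -⟩ := hT.2 _ hj
    obtain ⟨g, hg⟩ := exists_eq_incl_mul hj (by rw [← mul_assoc, e.2.eq]) (hT.1 ht) hts
    refine ⟨⟨t, ht⟩, g, Subtype.ext (key.trans ?_)⟩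
    change _ = ι k e _ * cls k e t
    rw [ι_single, smul_mul_assoc, cls_mul, hg]

theorem coords_injective [Finite S] (hT' : IsRTransversal e T') :
    Function.Injective (coords k V hT') := fun f g h => by
  refine Subtype.ext (LinearMap.ext fun y => ?_)
  obtain ⟨a, rfl⟩ := exists_leftS_unitL k e y
  induction a using MonoidAlgebra.induction_linear with
  | zero => simp
  | add x y hx hy => simp only [map_add, LinearMap.add_apply, hx, hy]
  | single s r =>
    rcases hT'.leftS_single s r with h0 | ⟨t, g', ht⟩
    · rw [h0, map_zero, map_zero]
    · rw [ht, f.2, g.2]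
      exact congrArg (act k · _) (congrFun h t)

variable (k e) in
open Classical in
/-- The function on `S` with `t g ↦ w(t) g` for `t ∈ T'` and `g ∈ G_e`, and `s ↦ 0` for the other
elements `s`. -/
noncomputable def coordFun (w : T' → V) (s : S) : V :=
  if h : ∃ p : T' × MaxSubgroup e, s = p.1.1 * incl e p.2 then
    act k (w h.choose.1) (MonoidAlgebra.single h.choose.2 (1 : k))
  else 0

theorem coordFun_mul_incl (hT' : IsRTransversal e T') (w : T' → V) (t : T')
    (g : MaxSubgroup e) :
    coordFun k e w (t.1 * incl e g) = act k (w t) (MonoidAlgebra.single g (1 : k)) := by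
  have h : ∃ p : T' × MaxSubgroup e, t.1 * incl e g = p.1.1 * incl e p.2 := ⟨(t, g), rfl⟩
  rw [coordFun, dif_pos h]
  have hp := h.choose_spec
  -- The choice is harmless because the factorization is unique: the `ℛ`-class determines `t`, and
  -- cancellation determines `g`.
  generalize h.choose = p at hp
  obtain ⟨t', g'⟩ := p
  have htt : t = t' := Subtype.ext <| (hT'.2 _ (mul_incl_mem_jClass (hT'.1 t.2) g)).unique
    ⟨t.2, mem_rClass_mul_incl (hT'.1 t.2) g⟩
    ⟨t'.2, by rw [hp]; exact mem_rClass_mul_incl (hT'.1 t'.2) g'⟩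
  subst htt
  rw [mul_incl_cancel (hT'.1 t.2) hp]

/-- Outside the elements `t g` both sides are `0`: if `s g` factors, multiplying by `g⁻¹` factors
`s`, since `s e = s`. -/
theorem coordFun_mul (hT' : IsRTransversal e T') (w : T' → V) {s : S} (hs : s * e.1 = s)
    (g : MaxSubgroup e) :
    coordFun k e w (s * incl e g)
      = act k (coordFun k e w s) (MonoidAlgebra.single g (1 : k)) := by
  by_cases h : ∃ p : T' × MaxSubgroup e, s = p.1.1 * incl e p.2
  · obtain ⟨⟨t, g'⟩, rfl⟩ := h
    rw [mul_assoc, ← map_mul, coordFun_mul_incl hT', coordFun_mul_incl hT', ← act_mul,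
      MonoidAlgebra.single_mul_single, one_mul]
  · have h' : ¬ ∃ p : T' × MaxSubgroup e, s * incl e g = p.1.1 * incl e p.2 := by
      rintro ⟨⟨t, g'⟩, ht⟩
      refine h ⟨(t, g' * g⁻¹), ?_⟩
      change s = t.1 * incl e (g' * g⁻¹)
      rw [map_mul, ← mul_assoc, ← ht, mul_assoc, incl_mul_inv, hs]
    rw [coordFun, dif_neg h', coordFun, dif_neg h, zero_act]

variable (k e) in
/-- The linear extension of `coordFun` to `kS`. -/
noncomputable def coordLin (w : T' → V) : MonoidAlgebra k S →ₗ[k] V :=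
  (Finsupp.linearCombination k (coordFun k e w)).comp
    (MonoidAlgebra.coeffLinearEquiv k).toLinearMap

theorem coordLin_single (w : T' → V) (s : S) (r : k) :
    coordLin k e w (MonoidAlgebra.single s r) = r • coordFun k e w s :=
  Finsupp.linearCombination_single k r s

/-- By bilinearity this is `coordFun_mul`; the factor `e` supplies its hypothesis `s e = s`. -/
theorem coordLin_mul_kincl (hT' : IsRTransversal e T') (w : T' → V) (a : MonoidAlgebra k S)
    (b : kG k e) :
    coordLin k e w (a * MonoidAlgebra.single e.1 (1 : k) * kincl k e b)
      = act k (coordLin k e w (a * MonoidAlgebra.single e.1 (1 : k))) b := by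
  induction a using MonoidAlgebra.induction_linear with
  | zero => simp
  | add x y hx hy => rw [add_mul, add_mul, map_add, map_add, hx, hy, add_act]
  | single s r =>
    induction b using MonoidAlgebra.induction_linear with
    | zero => simp
    | add x y hx hy => rw [map_add, mul_add, map_add, hx, hy, act_add]
    | single g c =>
      rw [kincl_single, MonoidAlgebra.single_mul_single, MonoidAlgebra.single_mul_single,
        coordLin_single, coordLin_single, coordFun_mul hT' w (by rw [mul_assoc, e.2.eq]),
        smul_act, mul_one, mul_smul, ← act_smul, MonoidAlgebra.smul_single, smul_eq_mul, mul_one]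

/-- The prescribed values extend to `t g ↦ w(t) g`. This descends to `A_J` because every `t g` lies
in `J`. -/
theorem coords_surjective (hV : IsMinimalMod k (kG k e) V) (hT' : IsRTransversal e T') :
    Function.Surjective (coords k V hT') := fun w => by
  have h0 : ∀ s ∈ notAbove (jClass e.1), coordLin k e w (MonoidAlgebra.single s 1) = 0 := by
    intro s hs
    rw [coordLin_single, coordFun, dif_neg, smul_zero]
    rintro ⟨⟨t, g⟩, rfl⟩
    exact (mem_notAbove_iff e).1 hs
      (mem_principalIdeal_of_mem_jClass e (mul_incl_mem_jClass (hT'.1 t.2) g))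
  refine ⟨⟨(AJ.lift (coordLin k e w) h0).comp (Ae k e).subtype, fun y b => ?_⟩, funext fun t => ?_⟩
  · obtain ⟨a, rfl⟩ := exists_leftS_unitL k e y
    exact coordLin_mul_kincl hT' w a b
  · change coordLin k e w (MonoidAlgebra.single t.1 (1 : k)) = w t
    have h1 := coordFun_mul_incl (k := k) hT' w t 1
    rw [incl_one, mul_e_of_mem_lClass e (hT'.1 t.2)] at h1
    rw [coordLin_single, one_smul, h1]
    exact hV.act_one _

/-- All of `G_e` lies in `J`, so `θ` kills a product outside `J`, matching the zero entries. -/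
theorem pairing_ofR_ofL [Finite S] (hT : IsLTransversal e T) (hT' : IsRTransversal e T') (b : T)
    (a : T') : pairing k e (ofR k e ⟨b.1, hT.1 b.2⟩) (ofL k e ⟨a.1, hT'.1 a.2⟩)
      = sandwich k hT hT' b a := by
  change θ k e (cls k e b.1 * cls k e a.1) = _
  rw [cls_mul, sandwich]
  split_ifs with h
  · have hg := (exists_incl_eq_mul hT hT' b a h).choose_spec
    generalize (exists_incl_eq_mul hT hT' b a h).choose = g at hg
    rw [← hg, θ_cls_incl]
  · refine θ_cls_of_notMem k e ?_
    rintro ⟨g, hg⟩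
    exact h (hg ▸ incl_mem_jClass e g)

theorem coords_VC_tmul [Finite S] (hT : IsLTransversal e T) (hT' : IsRTransversal e T') (v : V)
    (b : T) :
    coords k V hT' ((VC k e V).1 (Ind.tmul k e V v (ofR k e ⟨b.1, hT.1 b.2⟩)))
      = row k V hT hT' v b := funext fun a => by
  change ((VC k e V).1 (Ind.tmul k e V v _)).1 _ = act k v (sandwich k hT hT' b a)
  rw [VC_tmul_apply, pairing_ofR_ofL]

/-- By `IsLTransversal.rightS_single` each `v ⊗ x` is a sum of terms `v' ⊗ λ_b`, with the group
coefficients moved into `V`. Linearity of a row in its vector then reduces to `X`. -/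
theorem map_coords_image_VC [Finite S] (hT : IsLTransversal e T) (hT' : IsRTransversal e T')
    {X : Set V} (hX : Submodule.span k X = ⊤) :
    (image (VC k e V)).toSubmodule.map (coords k V hT')
      = Submodule.span k {r | ∃ v ∈ X, ∃ b : T, r = row k V hT hT' v b} := by
  apply le_antisymm
  · have hrow : ∀ v (b : T), row k V hT hT' v b
        ∈ Submodule.span k {r | ∃ v ∈ X, ∃ b : T, r = row k V hT hT' v b} := by
      intro v b
      have hv : v ∈ Submodule.span k X := by rw [hX]; trivial
      rw [← coords_VC_tmul]
      induction hv using Submodule.span_induction with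
      | mem v hv => exact Submodule.subset_span ⟨v, hv, b, coords_VC_tmul hT hT' v b⟩
      | zero => simp
      | add x y _ _ hx hy =>
        simp only [map_add, LinearMap.add_apply]
        exact add_mem hx hy
      | smul c x _ hx =>
        simp only [map_smul, LinearMap.smul_apply]
        exact Submodule.smul_mem _ c hx
    rintro _ ⟨_, ⟨z, rfl⟩, rfl⟩
    induction z using Ind.induction with
    | h0 => simp
    | ha x y hx hy => rw [map_add, map_add]; exact add_mem hx hy
    | ht v x =>
      obtain ⟨a, rfl⟩ := exists_rightS_unitR k e x
      induction a using MonoidAlgebra.induction_linear with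
      | zero => simp
      | add x y hx hy => simp only [map_add]; exact add_mem hx hy
      | single s r =>
        rcases hT.rightS_single s r with h0 | ⟨b, g, hb⟩
        · rw [h0]; simp
        · rw [hb, ← Ind.tmul_act, coords_VC_tmul]
          exact hrow _ _
  · refine Submodule.span_le.2 ?_
    rintro _ ⟨v, -, b, rfl⟩
    exact ⟨_, ⟨_, rfl⟩, coords_VC_tmul hT hT' v b⟩

end Coordinates

end SgpRep

theorem mainTheorem4 {k : Type*} [CommSemiring k] {S : Type*} [Semigroup S] [Finite S]
    (e : Idem S) (V : Type*) [AddCommMonoid V] [Module k V] [RightModule k (kG k e) V]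
    (hV : IsIrreducibleMod k (kG k e) V) :
    -- the image of `V ⊗ C_J` is the irreducible `kS`-module corresponding to `V`
    (Corresponds k (image (VC k e V)).toSubmodule e V ∧
      ∀ (M : Type*) [AddCommMonoid M] [Module k M] [RightModule k (MonoidAlgebra k S) M],
        Corresponds k M e V → RIso k (MonoidAlgebra k S) M (image (VC k e V)).toSubmodule) ∧
    -- in coordinates, `V ⊗ C_J` is multiplication by the sandwich matrix, and its image is
    -- the `k`-span of the rows of `V ⊗ C_J`
    (∀ (T T' : Set S) (hT : IsLTransversal e T) (hT' : IsRTransversal e T'),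
      Function.Bijective (coords k V hT') ∧
      (∀ (v : V) (b : T),
        coords k V hT' ((VC k e V).1 (Ind.tmul k e V v (ofR k e ⟨b.1, hT.1 b.2⟩))) =
          row k V hT hT' v b) ∧
      ∀ X : Set V, Submodule.span k X = ⊤ →
        (image (VC k e V)).toSubmodule.map (coords k V hT') =
          Submodule.span k {r | ∃ v ∈ X, ∃ b : T, r = row k V hT hT' v b}) ∧
    -- homomorphisms from `Ind_J(V)` to `Coind_J(V)`
    (VC k e V ≠ 0 ∧
      (∃ Φ : RHom k (MonoidAlgebra k S) (Ind k e V) (Coind k e V) ≃ₗ[k] RHom k (kG k e) V V,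
        ∀ φ v, (Φ φ).1 v =
          (φ.1 (Ind.tmul k e V v ⟨cls k e e.1, (mem_eA k e).2 (by rw [cls_mul, e.2.eq])⟩)).1
            ⟨cls k e e.1, (mem_Ae k e).2 (by rw [cls_mul, e.2.eq])⟩) ∧
      ∀ φ : RHom k (MonoidAlgebra k S) (Ind k e V) (Coind k e V), φ ≠ 0 →
        (∀ x y, φ.1 x = φ.1 y ↔ radical k (MonoidAlgebra k S) (Ind k e V) x y) ∧
        (image φ).toSubmodule = (image (VC k e V)).toSubmodule ∧
        (image φ).toSubmodule = socle k (MonoidAlgebra k S) (Coind k e V)) := by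
  refine ⟨⟨⟨⟨image_VC_isSimpleMod hV, image_VC_isMinimalMod hV⟩, image_VC_hasApex hV,
    image_VC_res hV.2⟩, fun M _ _ _ hM => hM.rIso hV⟩, fun T T' hT hT' =>
    ⟨⟨coords_injective hT', coords_surjective hV.2 hT'⟩, coords_VC_tmul hT hT',
      fun X hX => map_coords_image_VC hT hT' hX⟩, VC_ne_zero hV.2,
    ⟨LinearEquiv.ofBijective (evalHom k e V) ⟨evalHom_injective, evalHom_surjective hV.2⟩,
      fun _ _ => rfl⟩, fun φ hφ => ⟨ker_iff_radical hV.1 hφ, image_eq_image_VC hV hφ, ?_⟩⟩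
  rw [image_eq_image_VC hV hφ, socle_Coind hV]
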